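/- Let $n \ge 2$ be an even integer. For $x \in \mathbb{Z}$ let $h_x = \{x, x+1, \ldots, x+n-1\}$, and identify a configuration of opinions $0$ and $1$ on $\mathbb{Z}$ with the set $\eta \subset \mathbb{Z}$ of vertices with opinion $1$. The one-dimensional majority rule model $(\eta_t)_{t \ge 0}$ started from $\eta_0 \subset \mathbb{Z}$ is the process obtained from independent Poisson processes with intensity one, one for each $h_x$, as follows: at each arrival time $t$ of the Poisson process attached to $h_x$, all the vertices of $h_x$ take opinion $1$ if $\mathrm{card}(\eta_{t-} \cap h_x) \ge n/2$, and all of them take opinion $0$ otherwise; a vertex does not change its opinion at other times. **Theorem.** Opinion $1$ wins: if $\eta_0 \subset \mathbb{Z}$ is any configuration such that $\mathrm{card}(\eta_0 \cap h_x) \ge n/2$ for infinitely many $x \in \mathbb{Z}$ (in particular, if infinitely many hyperedges $h_x$ have a strict majority of vertices of type $1$), then for all $x \in \mathbb{Z}$, $$P(\eta_t(x) = 0) \to 0 \quad \text{as } t \to \infty.$$ -/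

import Mathlib

open MeasureTheory ProbabilityTheory Filter Topology
open scoped NNReal

/-- Configurations are identified with the set of vertices holding opinion `1`.
`MajorityOne h η`: at least half of the vertices of the hyperedge `h` hold opinion `1` in `η`,
so that the majority rule, with ties broken in favour of opinion `1`, selects opinion `1`. -/
def MajorityOne {V : Type*} (h : Finset V) (η : Set V) : Prop :=
  h.card ≤ 2 * (η ∩ (h : Set V)).ncard

open Classical in
/-- The update of the hyperedge `h`: all its vertices simultaneously adopt the majority opinion of
`h`, and opinion `1` in case of a tie; the other vertices keep their opinion. -/
noncomputable def majorityUpdate {V : Type*} (h : Finset V) (η : Set V) : Set V :=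
  if MajorityOne h η then η ∪ (h : Set V) else η \ (h : Set V)

/-- The hyperedge `{x, x + 1, …, x + n - 1}` of the one-dimensional lattice. -/
noncomputable def block (n : ℕ) (x : ℤ) : Finset ℤ := Finset.Ico x (x + n)

/-- The arrival time number `j + 1` of the clock attached to `x`, for the interarrival times
`ξ x 0, ξ x 1, …`. -/
def arrivalTime {I Ω : Type*} (ξ : I → ℕ → Ω → ℝ) (x : I) (j : ℕ) (ω : Ω) : ℝ :=
  ∑ i ∈ Finset.range (j + 1), ξ x i ω

/-- The `ξ x i` are the interarrival times of a family, indexed by `I`, of independent Poisson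
processes with intensity one: they are independent exponential variables with parameter one. -/
structure IsPoissonClocks {I Ω : Type*} [MeasurableSpace Ω] (P : Measure Ω)
    (ξ : I → ℕ → Ω → ℝ) : Prop where
  hasLaw : ∀ x i, HasLaw (ξ x i) (expMeasure 1) P
  indep : iIndepFun (fun p : I × ℕ => ξ p.1 p.2) P

/-- The configuration `η_{t-}` just before time `t`, along the path `η`. -/
def leftLimit {V : Type*} (η : ℝ≥0 → Set V) (t : ℝ≥0) : Set V :=
  {z | ∀ᶠ s in 𝓝[<] t, z ∈ η s}

/-- The path `η` starts from `η₀` and is driven by the clocks whose arrival times are `T x j`: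
at each arrival time of the clock of `x` the vertices of the block starting at `x` take the
majority opinion that the block has just before that time, and a vertex keeps its opinion as long
as no clock of a block containing it rings. -/
structure IsMajorityPath (n : ℕ) (η₀ : Set ℤ) (T : ℤ → ℕ → ℝ) (η : ℝ≥0 → Set ℤ) : Prop where
  init : η 0 = η₀
  update : ∀ (x : ℤ) (j : ℕ) (t : ℝ≥0), (t : ℝ) = T x j → ∀ z ∈ block n x,
    (z ∈ η t ↔ z ∈ majorityUpdate (block n x) (leftLimit η t))
  keep : ∀ (z : ℤ) (s t : ℝ≥0), s ≤ t →
    (∀ (x : ℤ) (j : ℕ), z ∈ block n x → T x j ∉ Set.Ioc (s : ℝ) t) → (z ∈ η t ↔ z ∈ η s)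

/-- `η` is the one-dimensional majority rule model with blocks of size `n` started from `η₀`,
through its graphical construction: independent Poisson clocks with intensity one are attached to
the blocks, and almost every path is driven by these clocks. -/
def IsMajorityRuleProcess {Ω : Type*} [MeasurableSpace Ω] (P : Measure Ω) (n : ℕ) (η₀ : Set ℤ)
    (η : ℝ≥0 → Ω → Set ℤ) : Prop :=
  ∃ ξ : ℤ → ℕ → Ω → ℝ, IsPoissonClocks P ξ ∧
    ∀ᵐ ω ∂P, IsMajorityPath n η₀ (fun x j => arrivalTime ξ x j ω) (fun t => η t ω)

/-!
The majority update is monotone in the configuration, and ties favour opinion `1`. Hence an interval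
of opinion `1`, surrounded by opinion `0` in the worst case, has ends which are random walks: with
`n = 2 * m`, an end moves outwards by `1, …, m` and inwards by `1, …, m - 1`, each at rate one. For
small `θ > 0` the exponential `exp (-θ R)` of the right end `R` therefore decreases at an exponential
rate on average (`exists_exponential_drift`, `sum_exp_rightEnd_le`), so that a long interval survives
and covers a given vertex with probability close to one (`badBound_of_Icc_subset`).

Long intervals do appear. If the block at `y` has a majority of opinion `1`, and the first `K` rings
among the finitely many clocks near `y` are those of `y, y + 1, …, y + K - 1` in this order, then an
interval of length `n + K - 1` is created. This has a probability which does not depend on `y`, and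
attempts at distant sites are independent. Instead of formalizing this independence, the proof uses
that the product over the sites of the probabilities of failure is preserved on average by each ring
(`sum_prod_stageWeight`, `badBound_of_stageHolds`).

Everything is computed in a finite window `[-M, M]`. The dynamics in the window, with opinion `0`
outside, is driven by finitely many clocks and is a lower bound of the process
(`badAt_of_isMajorityPath`). By the memoryless property the clocks start afresh after the first ring
(`lintegral_ringsFirst`). Conditioning on this ring gives, by induction on the number of rings,
a comparison principle: functions `a + b exp (-γ t) + D t` of the state which are supersolutions of
the backward equation bound the probability of opinion `0` at `x` at time `t` (`BadBound.step`). The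
cut-off at the boundary of the window contributes `D t` with `D` of order `exp (-θ M)`, which
vanishes as `M → ∞` for fixed `t`; then let `t → ∞`.
-/

/-! ### Memorylessness of finitely many exponential clocks -/

instance : IsProbabilityMeasure (expMeasure 1) := isProbabilityMeasure_expMeasure one_pos

lemma expMeasure_one_eq : expMeasure 1 =
    (volume.restrict (Set.Ioi 0)).withDensity (fun s : ℝ => ENNReal.ofReal (Real.exp (-s))) := by
  have h : expMeasure 1 = volume.withDensity (exponentialPDF 1) := rfl
  rw [h, ← withDensity_indicator measurableSet_Ioi]
  refine withDensity_congr_ae ?_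
  filter_upwards [Measure.ae_ne volume (0 : ℝ)] with s hs
  rw [exponentialPDF_eq]
  by_cases h0 : 0 < s
  · simp [h0, h0.le]
  · have : ¬ 0 ≤ s := fun h => h0 (lt_of_le_of_ne h (Ne.symm hs))
    simp [h0, this]

lemma lintegral_expMeasure_one {f : ℝ → ENNReal} (hf : Measurable f) :
    ∫⁻ s, f s ∂(expMeasure 1) = ∫⁻ s in Set.Ioi 0, ENNReal.ofReal (Real.exp (-s)) * f s := by
  rw [expMeasure_one_eq, lintegral_withDensity_eq_lintegral_mul _ (by fun_prop) hf]
  rfl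

lemma ae_pos_expMeasure_one : ∀ᵐ s ∂(expMeasure 1), 0 < s := by
  rw [expMeasure_one_eq]
  exact (withDensity_absolutelyContinuous _ _).ae_le (ae_restrict_mem measurableSet_Ioi)

lemma expMeasure_one_memoryless {s : ℝ} (hs : 0 ≤ s) {B : Set ℝ} (hB : MeasurableSet B) :
    expMeasure 1 {h | s < h ∧ h - s ∈ B} = ENNReal.ofReal (Real.exp (-s)) * expMeasure 1 B := by
  have hm : MeasurableSet {h : ℝ | s < h ∧ h - s ∈ B} :=
    (measurableSet_lt measurable_const measurable_id).inter
      ((measurable_id.sub measurable_const) hB)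
  rw [← lintegral_indicator_one hm, ← lintegral_indicator_one hB,
    lintegral_expMeasure_one (measurable_one.indicator hm),
    lintegral_expMeasure_one (measurable_one.indicator hB),
    ← lintegral_indicator measurableSet_Ioi, ← lintegral_indicator measurableSet_Ioi,
    ← lintegral_add_right_eq_self _ s, ← lintegral_const_mul' _ _ ENNReal.ofReal_ne_top]
  refine lintegral_congr fun h => ?_
  by_cases h0 : 0 < h
  · have h1 : 0 < h + s := by linarith
    by_cases hb : h ∈ B
    · simp [Set.indicator, h0, h1, hb, ← ENNReal.ofReal_mul (Real.exp_pos _).le, ← Real.exp_add]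
    · simp [Set.indicator, h0, h1, hb]
  · by_cases h1 : 0 < h + s <;> simp [Set.indicator, h0, h1]

/-- The law of the sequence of interarrival times of one Poisson clock of intensity one. -/
noncomputable def clockLaw : Measure (ℕ → ℝ) := Measure.infinitePi fun _ => expMeasure 1

instance : IsProbabilityMeasure clockLaw := by unfold clockLaw; infer_instance

/-- The sequence `a, ρ 0, ρ 1, …`. -/
def consSeq (a : ℝ) (ρ : ℕ → ℝ) : ℕ → ℝ
  | 0 => a
  | j + 1 => ρ j

lemma measurable_consSeq : Measurable fun p : ℝ × (ℕ → ℝ) => consSeq p.1 p.2 := by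
  refine measurable_pi_iff.2 fun j => ?_
  cases j with
  | zero => exact measurable_fst
  | succ j => exact (measurable_pi_apply j).comp measurable_snd

lemma map_consSeq_clockLaw :
    ((expMeasure 1).prod clockLaw).map (fun p => consSeq p.1 p.2) = clockLaw := by
  refine Measure.eq_infinitePi _ fun s t ht => ?_
  classical
  rw [Measure.map_apply measurable_consSeq (MeasurableSet.pi s.countable_toSet fun i _ => ht i)]
  let t' : ℕ → Set ℝ := fun i => if i ∈ s then t i else Set.univ
  have ht' : ∀ i, MeasurableSet (t' i) := fun i => by
    dsimp only [t']; split_ifs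
    exacts [ht i, MeasurableSet.univ]
  obtain ⟨n, hn⟩ := s.exists_nat_subset_range
  have hset : (fun p : ℝ × (ℕ → ℝ) => consSeq p.1 p.2) ⁻¹' (s : Set ℕ).pi t =
      t' 0 ×ˢ ((Finset.range n : Set ℕ).pi fun j => t' (j + 1)) := by
    ext ⟨a, ρ⟩
    simp only [Set.mem_preimage, Set.mem_pi, Finset.mem_coe, Set.mem_prod, Finset.mem_range]
    constructor
    · intro h
      refine ⟨?_, fun j _ => ?_⟩ <;> dsimp only [t'] <;> split_ifs with hs
      exacts [h 0 hs, trivial, h (j + 1) hs, trivial]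
    · rintro ⟨h0, h⟩ j hj
      cases j with
      | zero => simpa [t', hj, consSeq] using h0
      | succ j =>
        have := Finset.mem_range.1 (hn hj)
        simpa [t', hj, consSeq] using h j (by omega)
  rw [hset, Measure.prod_prod, clockLaw, Measure.infinitePi_pi _ (fun i _ => ht' (i + 1)),
    mul_comm, ← Finset.prod_range_succ' (fun i => expMeasure 1 (t' i)) n]
  have hsub : s ⊆ Finset.range (n + 1) := hn.trans (Finset.range_subset_range.2 n.le_succ)
  rw [← Finset.prod_subset hsub]
  · exact Finset.prod_congr rfl fun i hi => by simp [t', hi]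
  · intro i _ hi
    simp [t', hi]

lemma lintegral_clockLaw {f : (ℕ → ℝ) → ENNReal} (hf : Measurable f) :
    ∫⁻ ρ, f ρ ∂clockLaw = ∫⁻ a, ∫⁻ ρ, f (consSeq a ρ) ∂clockLaw ∂(expMeasure 1) := by
  conv_lhs => rw [← map_consSeq_clockLaw]
  rw [lintegral_map hf measurable_consSeq]
  exact lintegral_prod _ (hf.comp measurable_consSeq).aemeasurable

/-- The interarrival times counted from time `s`, for a clock which has not rung before. -/
def ageSeq (s : ℝ) (ρ : ℕ → ℝ) : ℕ → ℝ := consSeq (ρ 0 - s) fun j => ρ (j + 1)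

lemma measurable_ageSeq : Measurable fun p : ℝ × (ℕ → ℝ) => ageSeq p.1 p.2 := by
  refine measurable_consSeq.comp (f := fun p : ℝ × (ℕ → ℝ) => (p.2 0 - p.1, fun j => p.2 (j + 1))) ?_
  fun_prop

lemma clockLaw_memoryless {s : ℝ} (hs : 0 ≤ s) {B : Set (ℕ → ℝ)} (hB : MeasurableSet B) :
    clockLaw {ρ | s < ρ 0 ∧ ageSeq s ρ ∈ B} = ENNReal.ofReal (Real.exp (-s)) * clockLaw B := by
  have hm : MeasurableSet {ρ : ℕ → ℝ | s < ρ 0 ∧ ageSeq s ρ ∈ B} :=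
    (measurableSet_lt measurable_const (measurable_pi_apply 0)).inter
      ((measurable_ageSeq.comp (measurable_const.prodMk measurable_id)) hB)
  have key : ∀ {A : Set (ℕ → ℝ)}, MeasurableSet A → clockLaw A =
      ∫⁻ ρ, expMeasure 1 {a | consSeq a ρ ∈ A} ∂clockLaw := by
    intro A hA
    conv_lhs => rw [← map_consSeq_clockLaw]
    rw [Measure.map_apply measurable_consSeq hA,
      Measure.prod_apply_symm (measurable_consSeq hA)]
    rfl
  rw [key hm, key hB, ← lintegral_const_mul' _ _ ENNReal.ofReal_ne_top]
  refine lintegral_congr fun ρ => ?_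
  exact expMeasure_one_memoryless hs (B := {a | consSeq a ρ ∈ B})
    ((measurable_consSeq.comp (measurable_id.prodMk measurable_const)) hB)

/-- The law of `N` independent clocks. -/
noncomputable def clocksLaw (N : ℕ) : Measure (Fin N → ℕ → ℝ) := Measure.pi fun _ => clockLaw

instance (N : ℕ) : IsProbabilityMeasure (clocksLaw N) := by unfold clocksLaw; infer_instance

lemma measurable_ageSeq_pi {N : ℕ} (s : ℝ) :
    Measurable fun (ρ : Fin N → ℕ → ℝ) (j : Fin N) => ageSeq s (ρ j) :=
  measurable_pi_iff.2 fun j => measurable_ageSeq.comp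
    (measurable_const.prodMk (measurable_pi_apply j))

lemma measurableSet_forall_lt {N : ℕ} (s : ℝ) :
    MeasurableSet {ρ : Fin N → ℕ → ℝ | ∀ j, s < ρ j 0} := by
  refine measurableSet_setOfPred.2 (Measurable.forall fun j => ?_)
  exact measurableSet_setOfPred.1 (measurableSet_lt measurable_const (by fun_prop))

lemma clocksLaw_memoryless (N : ℕ) {s : ℝ} (hs : 0 ≤ s) :
    ((clocksLaw N).restrict {ρ | ∀ j, s < ρ j 0}).map (fun ρ j => ageSeq s (ρ j)) =
      ENNReal.ofReal (Real.exp (-(N * s))) • clocksLaw N := by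
  have hpos := Real.exp_pos (-(N * s))
  have hmul : ENNReal.ofReal (Real.exp (N * s)) * ENNReal.ofReal (Real.exp (-(N * s))) = 1 := by
    rw [← ENNReal.ofReal_mul (Real.exp_pos _).le, ← Real.exp_add]; simp
  have h : clocksLaw N = ENNReal.ofReal (Real.exp (N * s)) •
      ((clocksLaw N).restrict {ρ | ∀ j, s < ρ j 0}).map (fun ρ j => ageSeq s (ρ j)) := by
    refine Measure.pi_eq fun B hB => ?_
    rw [Measure.smul_apply, Measure.map_apply (measurable_ageSeq_pi s) (.univ_pi hB),
      Measure.restrict_apply (measurable_ageSeq_pi s (.univ_pi hB))]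
    have hset : (fun (ρ : Fin N → ℕ → ℝ) j => ageSeq s (ρ j)) ⁻¹' Set.univ.pi B ∩
        {ρ | ∀ j, s < ρ j 0} = Set.univ.pi fun j => {ρ | s < ρ 0 ∧ ageSeq s ρ ∈ B j} := by
      ext ρ
      simp only [Set.mem_inter_iff, Set.mem_preimage, Set.mem_univ_pi, Set.mem_ofPred_eq]
      exact ⟨fun h j => ⟨h.2 j, h.1 j⟩, fun h => ⟨fun j => (h j).2, fun j => (h j).1⟩⟩
    rw [hset, clocksLaw, Measure.pi_pi]
    simp only [clockLaw_memoryless hs (hB _), Finset.prod_mul_distrib, Finset.prod_const,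
      Finset.card_univ, Fintype.card_fin, smul_eq_mul]
    rw [← ENNReal.ofReal_pow (Real.exp_pos _).le, ← Real.exp_nat_mul, ← mul_assoc, mul_neg, hmul,
      one_mul]
  conv_rhs => rw [h]
  rw [smul_smul, mul_comm, hmul, one_smul]

/-- The interarrival times of the clocks counted from the first ring of the clock `i`, provided that
this is the first ring of all the clocks. -/
def residualClocks {N : ℕ} (i : Fin (N + 1)) (ρ : Fin (N + 1) → ℕ → ℝ) : Fin (N + 1) → ℕ → ℝ :=
  i.insertNth (fun l => ρ i (l + 1)) fun j => ageSeq (ρ i 0) (ρ (i.succAbove j))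

lemma measurable_insertNth {N : ℕ} (i : Fin (N + 1)) :
    Measurable fun p : (ℕ → ℝ) × (Fin N → ℕ → ℝ) =>
      (i.insertNth p.1 p.2 : Fin (N + 1) → ℕ → ℝ) :=
  (MeasurableEquiv.piFinSuccAbove (fun _ : Fin (N + 1) => ℕ → ℝ) i).symm.measurable

lemma measurable_residualClocks {N : ℕ} (i : Fin (N + 1)) : Measurable (residualClocks i) := by
  refine (measurable_insertNth i).comp (f := fun ρ : Fin (N + 1) → ℕ → ℝ =>
    ((fun l => ρ i (l + 1)), fun j => ageSeq (ρ i 0) (ρ (i.succAbove j)))) ?_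
  refine Measurable.prodMk (by fun_prop) (measurable_pi_iff.2 fun j => ?_)
  exact measurable_ageSeq.comp (f := fun ρ : Fin (N + 1) → ℕ → ℝ => (ρ i 0, ρ (i.succAbove j)))
    (by fun_prop)

lemma lintegral_clocksLaw_succ {N : ℕ} (i : Fin (N + 1)) {f : (Fin (N + 1) → ℕ → ℝ) → ENNReal}
    (hf : Measurable f) : ∫⁻ ρ, f ρ ∂(clocksLaw (N + 1)) =
      ∫⁻ a, ∫⁻ ρ, f (i.insertNth a ρ) ∂(clocksLaw N) ∂clockLaw := by
  have h := (measurePreserving_piFinSuccAbove (fun _ : Fin (N + 1) => clockLaw) i).symm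
  have h' := h.lintegral_comp hf
  rw [clocksLaw, ← h']
  exact lintegral_prod _ (hf.comp h.measurable).aemeasurable

/-- The clock `i` rings first. -/
def RingsFirst {N : ℕ} (i : Fin (N + 1)) (ρ : Fin (N + 1) → ℕ → ℝ) : Prop :=
  ∀ j, j ≠ i → ρ i 0 < ρ j 0

lemma measurableSet_ringsFirst {N : ℕ} (i : Fin (N + 1)) : MeasurableSet {ρ | RingsFirst i ρ} := by
  refine measurableSet_setOfPred.2 (Measurable.forall fun j => Measurable.imp measurable_const ?_)
  exact measurableSet_setOfPred.1 (measurableSet_lt (by fun_prop) (by fun_prop))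

/-- Markov property at the first ring: that the clock `i` rings first, and does so in `ds`, has
probability `exp (- (N + 1) s) ds`, and the clocks then start afresh. -/
lemma lintegral_ringsFirst {N : ℕ} (i : Fin (N + 1)) {g : ℝ → (Fin (N + 1) → ℕ → ℝ) → ENNReal}
    (hg : Measurable (Function.uncurry g)) :
    ∫⁻ ρ, {ρ | RingsFirst i ρ}.indicator (fun ρ => g (ρ i 0) (residualClocks i ρ)) ρ
        ∂(clocksLaw (N + 1)) =
      ∫⁻ s in Set.Ioi 0, ENNReal.ofReal (Real.exp (-((N + 1 : ℕ) * s))) *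
        ∫⁻ ρ, g s ρ ∂(clocksLaw (N + 1)) := by
  have hm1 : Measurable ({ρ | RingsFirst i ρ}.indicator
      fun ρ => g (ρ i 0) (residualClocks i ρ)) := by
    refine Measurable.indicator ?_ (measurableSet_ringsFirst i)
    exact hg.comp (f := fun ρ : Fin (N + 1) → ℕ → ℝ => (ρ i 0, residualClocks i ρ))
      (Measurable.prodMk (by fun_prop) (measurable_residualClocks i))
  rw [lintegral_clocksLaw_succ i hm1]
  have hg' : ∀ s, Measurable (g s) := fun s => hg.comp (measurable_const.prodMk measurable_id)
  have inner : ∀ a : ℕ → ℝ, 0 ≤ a 0 → ∫⁻ ρ, {ρ | RingsFirst i ρ}.indicator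
      (fun ρ => g (ρ i 0) (residualClocks i ρ)) (i.insertNth a ρ) ∂(clocksLaw N) =
      ENNReal.ofReal (Real.exp (-(N * a 0))) *
        ∫⁻ ρ, g (a 0) (i.insertNth (fun l => a (l + 1)) ρ) ∂(clocksLaw N) := by
    intro a ha
    have h1 : Measurable fun ρ : Fin N → ℕ → ℝ =>
        g (a 0) (i.insertNth (α := fun _ => ℕ → ℝ) (fun l => a (l + 1)) ρ) :=
      (hg' _).comp ((measurable_insertNth i).comp (measurable_const.prodMk measurable_id))
    rw [← smul_eq_mul, ← lintegral_smul_measure, ← clocksLaw_memoryless N ha,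
      lintegral_map h1 (measurable_ageSeq_pi _), ← lintegral_indicator (measurableSet_forall_lt _)]
    refine lintegral_congr fun ρ => ?_
    have h2 : i.insertNth (α := fun _ => ℕ → ℝ) a ρ ∈ {ρ | RingsFirst i ρ} ↔
        ρ ∈ {ρ : Fin N → ℕ → ℝ | ∀ j, a 0 < ρ j 0} := by
      simp only [Set.mem_ofPred_eq, RingsFirst]
      constructor
      · intro h j
        simpa using h (i.succAbove j) (Fin.succAbove_ne i j)
      · intro h j hj
        obtain ⟨k, rfl⟩ := Fin.exists_succAbove_eq hj
        simpa using h k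
    by_cases h3 : ρ ∈ {ρ : Fin N → ℕ → ℝ | ∀ j, a 0 < ρ j 0}
    · rw [Set.indicator_of_mem h3, Set.indicator_of_mem (h2.2 h3)]
      simp [residualClocks]
    · rw [Set.indicator_of_notMem h3, Set.indicator_of_notMem (fun h => h3 (h2.1 h))]
  have hpos : ∀ᵐ a ∂clockLaw, 0 < a 0 :=
    (measurePreserving_eval_infinitePi (fun _ : ℕ => expMeasure 1) 0).quasiMeasurePreserving.ae
      ae_pos_expMeasure_one
  have hm2 : Measurable fun p : (ℝ × (ℕ → ℝ)) × (Fin N → ℕ → ℝ) =>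
      g p.1.1 (i.insertNth (α := fun _ => ℕ → ℝ) p.1.2 p.2) :=
    hg.comp (f := fun p : (ℝ × (ℕ → ℝ)) × (Fin N → ℕ → ℝ) =>
      (p.1.1, i.insertNth (α := fun _ => ℕ → ℝ) p.1.2 p.2))
      (Measurable.prodMk (by fun_prop) ((measurable_insertNth i).comp
        (f := fun p : (ℝ × (ℕ → ℝ)) × (Fin N → ℕ → ℝ) => (p.1.2, p.2)) (by fun_prop)))
  have hm3 : Measurable fun p : ℝ × (ℕ → ℝ) =>
      ∫⁻ ρ, g p.1 (i.insertNth (α := fun _ => ℕ → ℝ) p.2 ρ) ∂(clocksLaw N) :=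
    hm2.lintegral_prod_right'
  have hm4 : Measurable fun a : ℕ → ℝ => ENNReal.ofReal (Real.exp (-(N * a 0))) *
        ∫⁻ ρ, g (a 0) (i.insertNth (α := fun _ => ℕ → ℝ) (fun l => a (l + 1)) ρ) ∂(clocksLaw N) :=
    Measurable.mul (by fun_prop) (hm3.comp (f := fun a : ℕ → ℝ => (a 0, fun l => a (l + 1)))
      (by fun_prop))
  rw [lintegral_congr_ae (hpos.mono fun a ha => inner a ha.le), lintegral_clockLaw hm4]
  simp only [consSeq]
  have hm5 : Measurable fun s : ℝ => ∫⁻ ρ : ℕ → ℝ, ENNReal.ofReal (Real.exp (-(N * s))) *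
      ∫⁻ ρ', g s (i.insertNth (α := fun _ => ℕ → ℝ) ρ ρ') ∂(clocksLaw N) ∂clockLaw :=
    Measurable.lintegral_prod_right' (f := fun p : ℝ × (ℕ → ℝ) =>
      ENNReal.ofReal (Real.exp (-(N * p.1))) *
      ∫⁻ ρ', g p.1 (i.insertNth (α := fun _ => ℕ → ℝ) p.2 ρ') ∂(clocksLaw N))
      (Measurable.mul (by fun_prop) hm3)
  rw [lintegral_expMeasure_one hm5]
  refine lintegral_congr fun s => ?_
  rw [lintegral_const_mul' _ _ ENNReal.ofReal_ne_top, ← mul_assoc,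
    ← ENNReal.ofReal_mul (Real.exp_pos _).le, ← Real.exp_add, ← lintegral_clocksLaw_succ i (hg' s)]
  congr 3
  push_cast
  ring_nf

lemma residualClocks_self {N : ℕ} (i : Fin (N + 1)) (ρ : Fin (N + 1) → ℕ → ℝ) (l : ℕ) :
    residualClocks i ρ i l = ρ i (l + 1) := by
  simp [residualClocks]

lemma residualClocks_of_ne {N : ℕ} {i j : Fin (N + 1)} (h : j ≠ i) (ρ : Fin (N + 1) → ℕ → ℝ) :
    residualClocks i ρ j = ageSeq (ρ i 0) (ρ j) := by
  obtain ⟨k, rfl⟩ := Fin.exists_succAbove_eq h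
  simp [residualClocks]

lemma lintegral_exp_neg_mul_Ioi {r : ℝ} (hr : 0 < r) (t : ℝ) :
    ∫⁻ s in Set.Ioi t, ENNReal.ofReal (Real.exp (-(r * s))) =
      ENNReal.ofReal (Real.exp (-(r * t)) / r) := by
  have hr' : -r < 0 := by linarith
  have h := integral_exp_mul_Ioi hr' t
  have hi := integrableOn_exp_mul_Ioi hr' t
  simp only [← neg_mul]
  rw [← ofReal_integral_eq_lintegral_ofReal hi (ae_of_all _ fun s => (Real.exp_pos _).le), h,
    neg_div_neg_eq]

lemma clocksLaw_ringsFirst {N : ℕ} (i : Fin (N + 1)) :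
    clocksLaw (N + 1) {ρ | RingsFirst i ρ} = ENNReal.ofReal (1 / (N + 1 : ℕ)) := by
  have h := lintegral_ringsFirst i (g := fun _ _ => 1) measurable_const
  have hN : (0 : ℝ) < (N + 1 : ℕ) := by positivity
  rw [lintegral_indicator (measurableSet_ringsFirst i)] at h
  simp only [lintegral_const, measure_univ, mul_one, Measure.restrict_apply, MeasurableSet.univ,
    Set.univ_inter, one_mul] at h
  rw [h, lintegral_exp_neg_mul_Ioi hN]
  simp

lemma ae_exists_ringsFirst (N : ℕ) :
    ∀ᵐ ρ ∂(clocksLaw (N + 1)), ∃ i, RingsFirst i ρ := by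
  have hm : MeasurableSet {ρ : Fin (N + 1) → ℕ → ℝ | ∃ i, RingsFirst i ρ} := by
    have : {ρ : Fin (N + 1) → ℕ → ℝ | ∃ i, RingsFirst i ρ} = ⋃ i, {ρ | RingsFirst i ρ} := by
      ext; simp
    rw [this]
    exact .iUnion measurableSet_ringsFirst
  refine (mem_ae_iff_prob_eq_one hm).2 ?_
  have hU : {ρ : Fin (N + 1) → ℕ → ℝ | ∃ i, RingsFirst i ρ} = ⋃ i, {ρ | RingsFirst i ρ} := by
    ext; simp
  rw [hU, measure_iUnion _ measurableSet_ringsFirst]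
  · simp only [clocksLaw_ringsFirst, tsum_fintype, Finset.sum_const, Finset.card_univ,
      Fintype.card_fin, nsmul_eq_mul]
    rw [← ENNReal.ofReal_natCast, ← ENNReal.ofReal_mul (by positivity),
      mul_one_div_cancel (by positivity), ENNReal.ofReal_one]
  · intro i j hij
    refine Set.disjoint_left.2 fun ρ hi hj => ?_
    exact lt_asymm (hi j (Ne.symm hij)) (hj i hij)

/-! ### Jump processes driven by finitely many clocks -/

section Jump

variable {S : Type*} {N : ℕ} (upd : Fin (N + 1) → S → S) (bad : S → Prop)

/-- The jump process started from the state `σ`, which applies `upd i` whenever the clock `i` rings,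
is in a bad state at time `t`. Realisations with more than `k` rings before time `t`, and those for
which no clock is strictly the first to ring, are counted as bad. -/
def BadAt : ℕ → S → ℝ → (Fin (N + 1) → ℕ → ℝ) → Prop
  | 0, _, _, _ => True
  | k + 1, σ, t, ρ => ∀ i, RingsFirst i ρ → (t < ρ i 0 → bad σ) ∧
      (ρ i 0 ≤ t → BadAt k (upd i σ) (t - ρ i 0) (residualClocks i ρ))

lemma measurableSet_badAt (k : ℕ) (σ : S) :
    MeasurableSet {p : ℝ × (Fin (N + 1) → ℕ → ℝ) | BadAt upd bad k σ p.1 p.2} := by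
  induction k generalizing σ with
  | zero => simp [BadAt]
  | succ k ih =>
    refine measurableSet_setOfPred.2 (Measurable.forall fun i => Measurable.imp ?_
      (Measurable.and (Measurable.imp ?_ measurable_const) (Measurable.imp ?_ ?_)))
    · exact measurableSet_setOfPred.1 (measurable_snd (measurableSet_ringsFirst i))
    · exact measurableSet_setOfPred.1 (measurableSet_lt (by fun_prop) (by fun_prop))
    · exact measurableSet_setOfPred.1 (measurableSet_le (by fun_prop) (by fun_prop))
    · have hm : Measurable fun p : ℝ × (Fin (N + 1) → ℕ → ℝ) =>
          (p.1 - p.2 i 0, residualClocks i p.2) :=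
        Measurable.prodMk (by fun_prop) ((measurable_residualClocks i).comp measurable_snd)
      exact measurableSet_setOfPred.1 (hm (ih (upd i σ)))

lemma measure_badAt_succ_le (k : ℕ) (σ : S) (t : ℝ) :
    clocksLaw (N + 1) {ρ | BadAt upd bad (k + 1) σ t ρ} ≤
      ∑ i, ∫⁻ s in Set.Ioi 0, ENNReal.ofReal (Real.exp (-((N + 1 : ℕ) * s))) *
        clocksLaw (N + 1) {ρ | (t < s → bad σ) ∧ (s ≤ t → BadAt upd bad k (upd i σ) (t - s) ρ)} := by
  let E : Fin (N + 1) → Set (ℝ × (Fin (N + 1) → ℕ → ℝ)) := fun i =>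
    {p | (t < p.1 → bad σ) ∧ (p.1 ≤ t → BadAt upd bad k (upd i σ) (t - p.1) p.2)}
  have hE : ∀ i, MeasurableSet (E i) := by
    intro i
    refine measurableSet_setOfPred.2
      (Measurable.and (Measurable.imp ?_ measurable_const) (Measurable.imp ?_ ?_))
    · exact measurableSet_setOfPred.1 (measurableSet_lt (by fun_prop) (by fun_prop))
    · exact measurableSet_setOfPred.1 (measurableSet_le (by fun_prop) (by fun_prop))
    · have hm : Measurable fun p : ℝ × (Fin (N + 1) → ℕ → ℝ) => (t - p.1, p.2) := by fun_prop
      exact measurableSet_setOfPred.1 (hm (measurableSet_badAt upd bad k (upd i σ)))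
  have hE' : ∀ i s, MeasurableSet {ρ | (s, ρ) ∈ E i} := fun i s =>
    (measurable_const.prodMk measurable_id) (hE i)
  have hle : ({ρ | BadAt upd bad (k + 1) σ t ρ} : Set (Fin (N + 1) → ℕ → ℝ)) ≤ᵐ[clocksLaw (N + 1)]
      ⋃ i, {ρ | RingsFirst i ρ ∧ (ρ i 0, residualClocks i ρ) ∈ E i} := by
    filter_upwards [ae_exists_ringsFirst N] with ρ ⟨i, hi⟩ hρ
    exact Set.mem_iUnion.2 ⟨i, hi, hρ i hi⟩
  refine (measure_mono_ae hle).trans ((measure_iUnion_fintype_le _ _).trans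
    (Finset.sum_le_sum fun i _ => le_of_eq ?_))
  have h := lintegral_ringsFirst i (g := fun s ρ => (E i).indicator 1 (s, ρ))
    (measurable_one.indicator (hE i))
  have h1 : ∀ s, ∫⁻ ρ, (E i).indicator 1 (s, ρ) ∂(clocksLaw (N + 1)) =
      clocksLaw (N + 1) {ρ | (t < s → bad σ) ∧
        (s ≤ t → BadAt upd bad k (upd i σ) (t - s) ρ)} := by
    intro s
    rw [show {ρ | (t < s → bad σ) ∧ (s ≤ t → BadAt upd bad k (upd i σ) (t - s) ρ)} =
      {ρ | (s, ρ) ∈ E i} from rfl, ← lintegral_indicator_one (hE' i s)]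
    rfl
  simp only [h1] at h
  rw [← h, ← lintegral_indicator_one]
  · refine lintegral_congr fun ρ => ?_
    by_cases h2 : RingsFirst i ρ <;> by_cases h3 : (ρ i 0, residualClocks i ρ) ∈ E i <;>
      simp [Set.indicator, h2, h3]
  · refine (measurableSet_ringsFirst i).inter ?_
    have hm : Measurable fun ρ : Fin (N + 1) → ℕ → ℝ => (ρ i 0, residualClocks i ρ) :=
      Measurable.prodMk (by fun_prop) (measurable_residualClocks i)
    exact hm (hE i)

/-- Comparison principle for the backward equation, in its integrated form: decompose at the first
ring, and integrate `s ↦ exp (-Λ s) * H (t - s)` by parts, where `Λ` is the total rate. -/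
lemma measure_badAt_succ_le_of_superSolution (k : ℕ) (σ : S) (G : Fin (N + 1) → ℝ → ℝ)
    (H H' : ℝ → ℝ) (hG0 : ∀ i t, 0 ≤ t → 0 ≤ G i t)
    (hG : ∀ i t, 0 ≤ t →
      clocksLaw (N + 1) {ρ | BadAt upd bad k (upd i σ) t ρ} ≤ ENNReal.ofReal (G i t))
    (hH : ∀ t, HasDerivAt H (H' t) t) (hH' : Continuous H')
    (hsup : ∀ t, 0 ≤ t → ∑ i, G i t ≤ (N + 1 : ℕ) * H t + H' t)
    (hH0 : 0 ≤ H 0) (hbad : bad σ → 1 ≤ H 0) {t : ℝ} (ht : 0 ≤ t) :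
    clocksLaw (N + 1) {ρ | BadAt upd bad (k + 1) σ t ρ} ≤ ENNReal.ofReal (H t) := by
  have hΛ : (0 : ℝ) < (N + 1 : ℕ) := by positivity
  set Λ : ℝ := ((N + 1 : ℕ) : ℝ) with hΛdef
  have hHc : Continuous H := continuous_iff_continuousAt.2 fun t => (hH t).continuousAt
  refine (measure_badAt_succ_le upd bad k σ t).trans ?_
  have hsplit : Set.Ioi (0 : ℝ) = Set.Ioc 0 t ∪ Set.Ioi t := (Set.Ioc_union_Ioi_eq_Ioi ht).symm
  have hdisj : Disjoint (Set.Ioc (0 : ℝ) t) (Set.Ioi t) := Set.Ioc_disjoint_Ioi le_rfl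
  have hearly : ∀ i, ∀ s ∈ Set.Ioc 0 t, ENNReal.ofReal (Real.exp (-(Λ * s))) *
        clocksLaw (N + 1) {ρ | (t < s → bad σ) ∧ (s ≤ t → BadAt upd bad k (upd i σ) (t - s) ρ)} ≤
      ENNReal.ofReal (Real.exp (-(Λ * s))) * ENNReal.ofReal (G i (t - s)) := by
    intro i s hs
    gcongr
    refine (measure_mono fun ρ hρ => ?_).trans (hG i (t - s) (sub_nonneg.2 hs.2))
    exact hρ.2 hs.2
  have hlate : ∀ i, ∀ s ∈ Set.Ioi t, ENNReal.ofReal (Real.exp (-(Λ * s))) *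
        clocksLaw (N + 1) {ρ | (t < s → bad σ) ∧ (s ≤ t → BadAt upd bad k (upd i σ) (t - s) ρ)} ≤
      ENNReal.ofReal (Real.exp (-(Λ * s))) * ENNReal.ofReal (H 0) := by
    intro i s hs
    gcongr
    by_cases hb : bad σ
    · exact prob_le_one.trans (ENNReal.one_le_ofReal.2 (hbad hb))
    · have : {ρ | (t < s → bad σ) ∧ (s ≤ t → BadAt upd bad k (upd i σ) (t - s) ρ)} = ∅ :=
        Set.eq_empty_of_forall_notMem fun ρ hρ => hb (hρ.1 hs)
      simp [this]
  have hcont : Continuous fun s => Real.exp (-(Λ * s)) * (Λ * H (t - s) + H' (t - s)) := by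
    fun_prop
  have hnn : ∀ s ∈ Set.Ioc 0 t, 0 ≤ Real.exp (-(Λ * s)) * (Λ * H (t - s) + H' (t - s)) := by
    intro s hs
    have h0 : 0 ≤ t - s := sub_nonneg.2 hs.2
    exact mul_nonneg (Real.exp_pos _).le
      ((Finset.sum_nonneg fun i _ => hG0 i _ h0).trans (hsup _ h0))
  have hFTC : ∫ s in Set.Ioc 0 t, Real.exp (-(Λ * s)) * (Λ * H (t - s) + H' (t - s)) =
      H t - Real.exp (-(Λ * t)) * H 0 := by
    rw [← intervalIntegral.integral_of_le ht,
      intervalIntegral.integral_eq_sub_of_hasDerivAt (f := fun s => -(Real.exp (-(Λ * s)) * H (t - s)))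
        _ (hcont.intervalIntegrable _ _)]
    · simp; ring
    · intro s _
      have h1 : HasDerivAt (fun s => Real.exp (-(Λ * s))) (Real.exp (-(Λ * s)) * -(Λ * 1)) s :=
        ((hasDerivAt_id s).const_mul Λ).neg.exp
      have h2 : HasDerivAt (fun s => H (t - s)) (-H' (t - s)) s :=
        HasDerivAt.comp_const_sub t s (hH (t - s))
      have h3 : HasDerivAt (fun s => -(Real.exp (-(Λ * s)) * H (t - s)))
          (-(Real.exp (-(Λ * s)) * -(Λ * 1) * H (t - s) + Real.exp (-(Λ * s)) * -H' (t - s))) s :=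
        (h1.mul h2).neg
      exact h3.congr_deriv (by ring)
  have hint : IntegrableOn (fun s => Real.exp (-(Λ * s)) * (Λ * H (t - s) + H' (t - s)))
      (Set.Ioc 0 t) := hcont.integrableOn_Ioc
  have hge : 0 ≤ H t - Real.exp (-(Λ * t)) * H 0 := by
    rw [← hFTC]; exact setIntegral_nonneg measurableSet_Ioc hnn
  have hA : ∑ i, ∫⁻ s in Set.Ioc 0 t, ENNReal.ofReal (Real.exp (-(Λ * s))) *
        clocksLaw (N + 1) {ρ | (t < s → bad σ) ∧ (s ≤ t → BadAt upd bad k (upd i σ) (t - s) ρ)} ≤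
      ENNReal.ofReal (H t - Real.exp (-(Λ * t)) * H 0) := by
    have hmf : ∀ i, AEMeasurable (fun s => ENNReal.ofReal (Real.exp (-(Λ * s))) *
        clocksLaw (N + 1) {ρ | (t < s → bad σ) ∧ (s ≤ t → BadAt upd bad k (upd i σ) (t - s) ρ)})
        (volume.restrict (Set.Ioc 0 t)) := by
      intro i
      have h1 : Measurable fun s : ℝ => clocksLaw (N + 1) {ρ | BadAt upd bad k (upd i σ) s ρ} :=
        measurable_measure_prodMk_left (measurableSet_badAt upd bad k (upd i σ))
      have h2 : Measurable fun s : ℝ => ENNReal.ofReal (Real.exp (-(Λ * s))) *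
          clocksLaw (N + 1) {ρ | BadAt upd bad k (upd i σ) (t - s) ρ} :=
        Measurable.mul (by fun_prop) (h1.comp (measurable_const.sub measurable_id))
      refine h2.aemeasurable.congr ?_
      filter_upwards [ae_restrict_mem measurableSet_Ioc] with s hs
      congr 2
      ext ρ
      exact ⟨fun h => ⟨fun h' => absurd hs.2 (not_le.2 h'), fun _ => h⟩, fun h => h.2 hs.2⟩
    rw [← lintegral_finsetSum' _ fun i _ => hmf i, ← hFTC,
      ofReal_integral_eq_lintegral_ofReal hint
        ((ae_restrict_mem measurableSet_Ioc).mono hnn)]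
    refine setLIntegral_mono' measurableSet_Ioc fun s hs => ?_
    have h0 : 0 ≤ t - s := sub_nonneg.2 hs.2
    refine (Finset.sum_le_sum fun i _ => hearly i s hs).trans ?_
    rw [← Finset.mul_sum, ← ENNReal.ofReal_sum_of_nonneg fun i _ => hG0 i _ h0,
      ← ENNReal.ofReal_mul (Real.exp_pos _).le]
    exact ENNReal.ofReal_le_ofReal (mul_le_mul_of_nonneg_left (hsup _ h0) (Real.exp_pos _).le)
  have hB : ∑ i, ∫⁻ s in Set.Ioi t, ENNReal.ofReal (Real.exp (-(Λ * s))) *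
        clocksLaw (N + 1) {ρ | (t < s → bad σ) ∧ (s ≤ t → BadAt upd bad k (upd i σ) (t - s) ρ)} ≤
      ENNReal.ofReal (Real.exp (-(Λ * t)) * H 0) := by
    calc _ ≤ ∑ i : Fin (N + 1), ENNReal.ofReal (Real.exp (-(Λ * t)) / Λ) * ENNReal.ofReal (H 0) := by
          refine Finset.sum_le_sum fun i _ =>
            (setLIntegral_mono' measurableSet_Ioi (hlate i)).trans ?_
          rw [lintegral_mul_const' _ _ ENNReal.ofReal_ne_top, lintegral_exp_neg_mul_Ioi hΛ]
      _ = _ := by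
          rw [Finset.sum_const, Finset.card_univ, Fintype.card_fin, nsmul_eq_mul,
            ← ENNReal.ofReal_natCast, ← ENNReal.ofReal_mul (by positivity),
            ← ENNReal.ofReal_mul hΛ.le]
          congr 1
          field_simp
  have htot : ENNReal.ofReal (H t) = ENNReal.ofReal (H t - Real.exp (-(Λ * t)) * H 0) +
      ENNReal.ofReal (Real.exp (-(Λ * t)) * H 0) := by
    rw [← ENNReal.ofReal_add hge (mul_nonneg (Real.exp_pos _).le hH0)]
    congr 1; ring
  rw [htot]
  refine le_trans (le_of_eq ?_) (add_le_add hA hB)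
  rw [← Finset.sum_add_distrib]
  refine Finset.sum_congr rfl fun i _ => ?_
  rw [hsplit, lintegral_union measurableSet_Ioi hdisj]

/-- The probability of a bad state at time `t` is at most `a + b exp (-γ t) + D t`, up to a term
which accounts for realisations with more than `k` rings. -/
def BadBound (γ D : ℝ) (k : ℕ) (σ : S) (a b : ℝ) : Prop :=
  ∀ t, 0 ≤ t → clocksLaw (N + 1) {ρ | BadAt upd bad k σ t ρ} ≤
    ENNReal.ofReal (a + b * Real.exp (-(γ * t)) + D * t + Real.exp ((N + 1 : ℕ) * t) / 2 ^ k)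

variable {upd bad} {γ D : ℝ} {k : ℕ} {σ : S} {a b : ℝ}

lemma BadBound.mono {a' b' : ℝ} (h : BadBound upd bad γ D k σ a b) (ha : a ≤ a') (hb : b ≤ b') :
    BadBound upd bad γ D k σ a' b' := fun t ht => by
  refine (h t ht).trans (ENNReal.ofReal_le_ofReal ?_)
  gcongr

lemma badBound_of_one_le (hD : 0 ≤ D) (ha : 1 ≤ a) (hb : 0 ≤ b) :
    BadBound upd bad γ D k σ a b := fun t ht => by
  refine prob_le_one.trans (ENNReal.one_le_ofReal.2 ?_)
  have h1 := mul_nonneg hb (Real.exp_pos (-(γ * t))).le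
  have h2 := mul_nonneg hD ht
  have h3 : 0 ≤ Real.exp ((N + 1 : ℕ) * t) / 2 ^ k := by positivity
  linarith

lemma badBound_zero (hD : 0 ≤ D) (ha : 0 ≤ a) (hb : 0 ≤ b) :
    BadBound upd bad γ D 0 σ a b := fun t ht => by
  refine prob_le_one.trans (ENNReal.one_le_ofReal.2 ?_)
  have h1 := mul_nonneg hb (Real.exp_pos (-(γ * t))).le
  have h2 := mul_nonneg hD ht
  have h3 : 1 ≤ Real.exp ((N + 1 : ℕ) * t) := Real.one_le_exp (by positivity)
  simp only [pow_zero, div_one]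
  linarith

/-- A bound propagates to one more ring if its constant part increases at rate at most `D₁` under
the generator, and its decaying part decreases at relative rate `γ`, up to `D₂`. -/
lemma BadBound.step {A B : Fin (N + 1) → ℝ} {D₁ D₂ : ℝ} (hγ : 0 ≤ γ) (ha : 0 ≤ a) (hb : 0 ≤ b)
    (hA : ∀ i, 0 ≤ A i) (hB : ∀ i, 0 ≤ B i) (hD₂ : 0 ≤ D₂) (hD : D₁ + D₂ ≤ D) (hD0 : 0 ≤ D)
    (h : ∀ i, BadBound upd bad γ D k (upd i σ) (A i) (B i))
    (hsA : ∑ i, A i ≤ (N + 1 : ℕ) * a + D₁) (hsB : ∑ i, B i ≤ ((N + 1 : ℕ) - γ) * b + D₂)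
    (hbad : bad σ → 1 ≤ a + b) : BadBound upd bad γ D (k + 1) σ a b := by
  intro t ht
  set Λ : ℝ := ((N + 1 : ℕ) : ℝ) with hΛ
  have hΛ0 : 0 ≤ Λ := by positivity
  refine measure_badAt_succ_le_of_superSolution upd bad k σ
    (fun i t => A i + B i * Real.exp (-(γ * t)) + D * t + Real.exp (Λ * t) / 2 ^ k)
    (fun t => a + b * Real.exp (-(γ * t)) + D * t + Real.exp (Λ * t) / 2 ^ (k + 1))
    (fun t => b * (Real.exp (-(γ * t)) * -(γ * 1)) + D * 1 +
      Real.exp (Λ * t) * (Λ * 1) / 2 ^ (k + 1))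
    ?_ h ?_ (by fun_prop) ?_ ?_ ?_ ht
  · intro i t ht
    have := hA i
    have := hB i
    positivity
  · intro t
    exact ((((hasDerivAt_id t).const_mul γ).neg.exp.const_mul b).const_add a |>.add
      ((hasDerivAt_id t).const_mul D)).add
      (((hasDerivAt_id t).const_mul Λ).exp.div_const _)
  · intro t ht
    have hexp : Real.exp (-(γ * t)) ≤ 1 := Real.exp_le_one_iff.2 (by nlinarith)
    have hexp0 := (Real.exp_pos (-(γ * t))).le
    simp only [Finset.sum_add_distrib, ← Finset.sum_mul, Finset.sum_const, Finset.card_univ,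
      Fintype.card_fin, nsmul_eq_mul, ← hΛ]
    have h1 : (∑ i, B i) * Real.exp (-(γ * t)) ≤
        ((Λ - γ) * b) * Real.exp (-(γ * t)) + D₂ := by
      have := mul_le_mul_of_nonneg_right hsB hexp0
      nlinarith
    have h2 : Λ * (Real.exp (Λ * t) / 2 ^ k) = Λ * (Real.exp (Λ * t) / 2 ^ (k + 1)) +
        Real.exp (Λ * t) * (Λ * 1) / 2 ^ (k + 1) := by
      field_simp; ring
    rw [h2]
    linarith
  · simp only [mul_zero, neg_zero, Real.exp_zero, mul_one, add_zero]
    positivity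
  · intro hs
    have := hbad hs
    simp only [mul_zero, neg_zero, Real.exp_zero, mul_one, add_zero]
    have h3 : (0 : ℝ) ≤ 1 / 2 ^ (k + 1) := by positivity
    linarith

end Jump

/-! ### Comparison with the dynamics in a finite window -/

lemma mem_block {n : ℕ} {x z : ℤ} : z ∈ block n x ↔ x ≤ z ∧ z < x + n := by
  simp [block]

lemma card_block (n : ℕ) (x : ℤ) : (block n x).card = n := by
  simp [block]

lemma MajorityOne.mono {V : Type*} {h : Finset V} {η η' : Set V} (hh : η ⊆ η')
    (hm : MajorityOne h η) : MajorityOne h η' := by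
  refine le_trans hm (Nat.mul_le_mul_left 2 (Set.ncard_le_ncard ?_ ?_))
  · exact Set.inter_subset_inter_left _ hh
  · exact h.finite_toSet.inter_of_right _

lemma majorityUpdate_mono {V : Type*} (h : Finset V) {η η' : Set V} (hh : η ⊆ η') :
    majorityUpdate h η ⊆ majorityUpdate h η' := by
  unfold majorityUpdate
  by_cases h1 : MajorityOne h η
  · rw [if_pos h1, if_pos (h1.mono hh)]
    exact Set.union_subset_union_left _ hh
  · rw [if_neg h1]
    split_ifs
    · exact Set.sdiff_subset.trans (hh.trans Set.subset_union_left)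
    · exact Set.sdiff_subset_sdiff_left hh

lemma mem_majorityUpdate_of_notMem {V : Type*} {h : Finset V} {η : Set V} {z : V} (hz : z ∉ h)
    (hη : z ∈ η) : z ∈ majorityUpdate h η := by
  unfold majorityUpdate
  split_ifs
  · exact Or.inl hη
  · exact ⟨hη, hz⟩

lemma mem_of_mem_majorityUpdate_of_notMem {V : Type*} {h : Finset V} {η : Set V} {z : V}
    (hz : z ∉ h) (hη : z ∈ majorityUpdate h η) : z ∈ η := by
  unfold majorityUpdate at hη
  split_ifs at hη
  · exact hη.resolve_right hz
  · exact hη.1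

lemma MajorityOne.mem_majorityUpdate {V : Type*} {h : Finset V} {η : Set V} {z : V}
    (hm : MajorityOne h η) (hz : z ∈ h ∨ z ∈ η) : z ∈ majorityUpdate h η := by
  unfold majorityUpdate
  rw [if_pos hm]
  exact hz.symm

/-- The update of the block starting at `z`, after which all the vertices outside `[-M, M]` are given
opinion `0`. -/
noncomputable def windowUpdate (n M : ℕ) (z : ℤ) (ζ : Set ℤ) : Set ℤ :=
  majorityUpdate (block n z) ζ ∩ Set.Icc (-(M : ℤ)) M

/-- An enumeration of sites including the starting points of all blocks that meet `[-M, M]`. -/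
def windowSite (n M : ℕ) (i : Fin (2 * M + n + 1)) : ℤ := (i : ℤ) - M - n

lemma windowSite_injective (n M : ℕ) : Function.Injective (windowSite n M) := by
  intro i j h
  unfold windowSite at h
  exact Fin.ext (by omega)

lemma exists_windowSite_eq {n M : ℕ} {z : ℤ} (h1 : -(M : ℤ) - n ≤ z) (h2 : z ≤ M) :
    ∃ i, windowSite n M i = z := by
  refine ⟨⟨(z + M + n).toNat, by omega⟩, ?_⟩
  simp only [windowSite]
  omega

lemma sum_windowSite {n M : ℕ} (F : ℤ → ℝ) :
    ∑ i, F (windowSite n M i) = ∑ z ∈ Finset.Icc (-(M : ℤ) - n) M, F z := by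
  refine Finset.sum_bij (fun i _ => windowSite n M i) ?_ ?_ ?_ ?_
  · intro i _
    have := i.2
    simp only [windowSite, Finset.mem_Icc]
    omega
  · exact fun i _ j _ h => windowSite_injective n M h
  · intro z hz
    rw [Finset.mem_Icc] at hz
    obtain ⟨i, hi⟩ := exists_windowSite_eq hz.1 hz.2
    exact ⟨i, Finset.mem_univ _, hi⟩
  · exact fun _ _ => rfl

lemma sum_range_ageSeq (s : ℝ) (ρ : ℕ → ℝ) (j : ℕ) :
    ∑ l ∈ Finset.range (j + 1), ageSeq s ρ l = ∑ l ∈ Finset.range (j + 1), ρ l - s := by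
  rw [Finset.sum_range_succ', Finset.sum_range_succ']
  simp only [ageSeq, consSeq]
  ring

/-- Along any path of the process, the dynamics restricted to a window and its clocks gives a lower
bound. The clocks outside the window do not matter, as their blocks do not meet the window. The
interarrival times `ρ` describe the arrivals after time `s`. -/
lemma badAt_of_isMajorityPath {n M : ℕ} {x : ℤ} (hx : x ∈ Set.Icc (-(M : ℤ)) M) {η₀ : Set ℤ}
    {T : ℤ → ℕ → ℝ} {η : ℝ≥0 → Set ℤ} (h : IsMajorityPath n η₀ T η) {t : ℝ≥0} (hxt : x ∉ η t)
    (k : ℕ) (s : ℝ≥0) (hst : s ≤ t) (ρ : Fin (2 * M + n + 1) → ℕ → ℝ) (hρ : ∀ i j, 0 < ρ i j)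
    (hT : ∀ i, ∀ r > (s : ℝ), (∃ j, T (windowSite n M i) j = r) ↔
      ∃ j, s + ∑ l ∈ Finset.range (j + 1), ρ i l = r)
    (ζ : Set ℤ) (hζM : ζ ⊆ Set.Icc (-(M : ℤ)) M) (hζ : ζ ⊆ η s) :
    BadAt (fun i => windowUpdate n M (windowSite n M i)) (fun ζ => x ∉ ζ) k ζ (t - s) ρ := by
  induction k generalizing s ρ ζ with
  | zero => trivial
  | succ k ih =>
    have hfirst : ∀ i j, ρ i 0 ≤ ∑ l ∈ Finset.range (j + 1), ρ i l := fun i j =>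
      Finset.single_le_sum (f := ρ i) (fun l _ => (hρ i l).le) (Finset.mem_range.2 j.succ_pos)
    -- a vertex of the window keeps its opinion until a window clock of one of its blocks rings
    have hkeep : ∀ z ∈ Set.Icc (-(M : ℤ)) M, ∀ r : ℝ≥0, s ≤ r →
        (∀ i, z ∈ block n (windowSite n M i) → (r : ℝ) < s + ρ i 0) → z ∈ η s → z ∈ η r := by
      intro z hz r hsr hr hzs
      refine (h.keep z s r hsr fun y j hy hmem => ?_).2 hzs
      have hy' := mem_block.1 hy
      obtain ⟨i, rfl⟩ := exists_windowSite_eq (n := n) (M := M) (z := y)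
        (by have := hz.1; omega) (by have := hz.2; omega)
      obtain ⟨l, hl⟩ := (hT i _ hmem.1).1 ⟨j, rfl⟩
      have h1 := hr i hy
      have h2 := hfirst i l
      have h3 := hmem.2
      linarith
    intro i hi
    have hmin : ∀ j, ρ i 0 ≤ ρ j 0 := fun j => by
      rcases eq_or_ne j i with rfl | hj
      · exact le_rfl
      · exact (hi j hj).le
    refine ⟨fun hlt hxζ => hxt ?_, fun hle => ?_⟩
    · refine hkeep x hx t hst (fun j _ => ?_) (hζ hxζ)
      have := hmin j
      linarith
    · have hi0 := hρ i 0
      set s' : ℝ≥0 := s + ⟨ρ i 0, hi0.le⟩ with hs'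
      have hs'c : (s' : ℝ) = s + ρ i 0 := rfl
      have hst' : s' ≤ t := by rw [← NNReal.coe_le_coe, hs'c]; linarith
      have hss' : s < s' := by rw [← NNReal.coe_lt_coe, hs'c]; linarith
      have heq : (t : ℝ) - s - ρ i 0 = t - s' := by rw [hs'c]; ring
      rw [heq]
      refine ih s' hst' _ ?_ ?_ _ Set.inter_subset_right ?_
      · intro j l
        rcases eq_or_ne j i with rfl | hj
        · rw [residualClocks_self]; exact hρ _ _
        · rw [residualClocks_of_ne hj]
          cases l with
          | zero => exact sub_pos.2 (hi j hj)
          | succ l => exact hρ j (l + 1)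
      · intro j r hr
        have hsr : (s : ℝ) < r := lt_trans (NNReal.coe_lt_coe.2 hss') hr
        rw [hT j r hsr]
        rcases eq_or_ne j i with rfl | hj
        · constructor
          · rintro ⟨l, hl⟩
            cases l with
            | zero => rw [hs'c] at hr; simp at hl; linarith
            | succ l =>
              refine ⟨l, ?_⟩
              rw [← hl, hs'c, Finset.sum_range_succ' _ (l + 1)]
              simp only [residualClocks_self]
              ring
          · rintro ⟨l, hl⟩
            refine ⟨l + 1, ?_⟩
            rw [← hl, hs'c, Finset.sum_range_succ' _ (l + 1)]
            simp only [residualClocks_self]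
            ring
        · simp only [residualClocks_of_ne hj, sum_range_ageSeq, hs'c]
          refine exists_congr fun l => ?_
          rw [show (s : ℝ) + ρ i 0 + (∑ l ∈ Finset.range (l + 1), ρ j l - ρ i 0) =
            s + ∑ l ∈ Finset.range (l + 1), ρ j l by ring]
      · rintro z ⟨hz, hzM⟩
        by_cases hzb : z ∈ block n (windowSite n M i)
        · obtain ⟨l, hl⟩ := (hT i s' (NNReal.coe_lt_coe.2 hss')).2 ⟨0, by simp [hs'c]⟩
          refine (h.update _ l s' hl.symm z hzb).2 (majorityUpdate_mono _ ?_ hz)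
          intro y hy
          have hev : ∀ᶠ r in 𝓝[<] s', r ∈ Set.Ioo s s' := Ioo_mem_nhdsLT hss'
          refine hev.mono fun r hr => hkeep y (hζM hy) r hr.1.le (fun j _ => ?_) (hζ hy)
          have h1 : (r : ℝ) < s' := NNReal.coe_lt_coe.2 hr.2
          have := hmin j
          linarith
        · refine hkeep z hzM s' hss'.le (fun j hj => ?_)
            (hζ (mem_of_mem_majorityUpdate_of_notMem hzb hz))
          have hji : j ≠ i := fun hji => hzb (hji ▸ hj)
          have := hi j hji
          linarith

lemma IsPoissonClocks.hasLaw_clocksLaw {Ω : Type*} [MeasurableSpace Ω] {P : Measure Ω}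
    [IsProbabilityMeasure P] {ξ : ℤ → ℕ → Ω → ℝ} (hξ : IsPoissonClocks P ξ) {N : ℕ}
    {e : Fin N → ℤ} (he : Function.Injective e) :
    HasLaw (fun ω i j => ξ (e i) j ω) (clocksLaw N) P := by
  have hind : iIndepFun (fun p : Fin N × ℕ => ξ (e p.1) p.2) P :=
    hξ.indep.precomp (g := fun p : Fin N × ℕ => (e p.1, p.2)) fun p q hpq => by
      simp only [Prod.mk.injEq] at hpq
      exact Prod.ext (he hpq.1) hpq.2
  have hae : AEMeasurable (fun ω (p : Fin N × ℕ) => ξ (e p.1) p.2 ω) P :=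
    aemeasurable_pi_iff.2 fun p => (hξ.hasLaw _ _).aemeasurable
  have hlaw := hind.hasLaw_infinitePi (μ := fun _ => expMeasure 1)
    (fun p : Fin N × ℕ => hξ.hasLaw (e p.1) p.2) hae
  have hc := Measure.infinitePi_map_curry (fun (_ : Fin N) (_ : ℕ) => expMeasure 1)
  have h2 : MeasurePreserving (MeasurableEquiv.curry (Fin N) ℕ ℝ)
      (Measure.infinitePi fun _ : Fin N × ℕ => expMeasure 1) (clocksLaw N) := by
    refine ⟨(MeasurableEquiv.curry (Fin N) ℕ ℝ).measurable, ?_⟩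
    rw [hc, clocksLaw, ← Measure.infinitePi_eq_pi]
    rfl
  exact h2.comp_hasLaw hlaw

lemma IsMajorityRuleProcess.measure_notMem_le {Ω : Type*} [MeasurableSpace Ω] {P : Measure Ω}
    [IsProbabilityMeasure P] {n : ℕ} {η₀ : Set ℤ} {η : ℝ≥0 → Ω → Set ℤ}
    (hη : IsMajorityRuleProcess P n η₀ η) {M : ℕ} {x : ℤ} (hx : x ∈ Set.Icc (-(M : ℤ)) M) (k : ℕ)
    (t : ℝ≥0) : P {ω | x ∉ η t ω} ≤ clocksLaw (2 * M + n + 1)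
      {ρ | BadAt (fun i => windowUpdate n M (windowSite n M i)) (fun ζ => x ∉ ζ) k
        (η₀ ∩ Set.Icc (-(M : ℤ)) M) t ρ} := by
  obtain ⟨ξ, hξ, hpath⟩ := hη
  have hlaw := hξ.hasLaw_clocksLaw (windowSite_injective n M)
  have hm : MeasurableSet {ρ | BadAt (fun i => windowUpdate n M (windowSite n M i))
      (fun ζ => x ∉ ζ) k (η₀ ∩ Set.Icc (-(M : ℤ)) M) t ρ} :=
    (measurable_const.prodMk measurable_id) (measurableSet_badAt _ _ k _)
  rw [← hlaw.map_eq, Measure.map_apply_of_aemeasurable hlaw.aemeasurable hm]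
  have hpos : ∀ᵐ ω ∂P, ∀ x j, 0 < ξ x j ω := by
    refine ae_all_iff.2 fun x => ae_all_iff.2 fun j => ?_
    have h1 := (hξ.hasLaw x j).map_eq
    have h2 := ae_pos_expMeasure_one
    rw [← h1] at h2
    exact ae_of_ae_map (hξ.hasLaw x j).aemeasurable h2
  refine measure_mono_ae ?_
  filter_upwards [hpath, hpos] with ω hω hωpos hxt
  have := badAt_of_isMajorityPath hx hω (t := t) hxt k 0 zero_le
    (fun i j => ξ (windowSite n M i) j ω) (fun i j => hωpos _ _)
    (fun i r _ => by simp [arrivalTime]) _ Set.inter_subset_right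
    (by rw [hω.init]; exact Set.inter_subset_left)
  rw [NNReal.coe_zero, sub_zero] at this
  exact this

/-! ### The drift of an interval of opinion `1` -/

/-- Because of the ties, each end of an interval moves outwards by `1, …, m` and inwards by
`1, …, m - 1`, at rate one each. Hence a small exponential of its position decreases on average. -/
lemma exists_exponential_drift {m : ℕ} (hm : 0 < m) : ∃ θ : ℝ, 0 < θ ∧ ∃ γ : ℝ, 0 < γ ∧ γ ≤ 1 ∧
    ∑ l ∈ Finset.range (m - 1), (Real.exp (θ * (l + 1)) - 1) +
      ∑ j ∈ Finset.range m, (Real.exp (-(θ * (j + 1))) - 1) ≤ -γ := by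
  obtain ⟨r, rfl⟩ : ∃ r, m = r + 1 := ⟨m - 1, by omega⟩
  simp only [Nat.add_sub_cancel]
  set F : ℝ → ℝ := fun θ => ∑ l ∈ Finset.range r, (Real.exp (θ * (l + 1)) - 1) +
      ∑ j ∈ Finset.range (r + 1), (Real.exp (-(θ * (j + 1))) - 1) with hF
  have hF0 : F 0 = 0 := by simp [hF]
  have hd : HasDerivAt F (-((r : ℝ) + 1)) 0 := by
    have h1 : ∀ c : ℝ, HasDerivAt (fun θ : ℝ => Real.exp (θ * c) - 1) c 0 := fun c => by
      simpa using (((hasDerivAt_id (0 : ℝ)).mul_const c).exp).sub_const 1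
    have h2 : ∀ c : ℝ, HasDerivAt (fun θ : ℝ => Real.exp (-(θ * c)) - 1) (-c) 0 := fun c => by
      simpa using (((hasDerivAt_id (0 : ℝ)).mul_const c).neg.exp).sub_const 1
    have h3 := (HasDerivAt.fun_sum (u := Finset.range r) fun l _ => h1 ((l : ℝ) + 1)).add
      (HasDerivAt.fun_sum (u := Finset.range (r + 1)) fun l _ => h2 ((l : ℝ) + 1))
    refine HasDerivAt.congr_deriv h3 ?_
    rw [Finset.sum_range_succ, Finset.sum_neg_distrib]
    ring
  have hneg : -((r : ℝ) + 1) < 0 := by have := r.cast_nonneg (α := ℝ); linarith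
  have hslope := (hasDerivAt_iff_tendsto_slope.1 hd).eventually (Iio_mem_nhds hneg)
  have hev : ∀ᶠ θ in 𝓝[>] (0 : ℝ), slope F 0 θ < 0 :=
    hslope.filter_mono (nhdsWithin_mono _ fun θ hθ => ne_of_gt hθ)
  obtain ⟨θ, hθ, hpos⟩ := (hev.and self_mem_nhdsWithin).exists
  have hFθ : F θ < 0 := by
    rw [slope_def_field, hF0, sub_zero, sub_zero] at hθ
    exact (div_neg_iff.1 hθ).resolve_left (fun h => absurd h.2 (not_lt.2 (le_of_lt hpos))) |>.1
  refine ⟨θ, hpos, min (-F θ) 1, lt_min (by linarith) one_pos, min_le_right _ _, ?_⟩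
  have := min_le_left (-F θ) 1
  change F θ ≤ _
  linarith

/-- The right end of an interval `[L, R]` of opinion `1`, cut off at `M`, after the update of the
block starting at `z`, if the left end is far away. -/
def rightEnd (n M : ℕ) (R z : ℤ) : ℤ :=
  if R + 1 - n < z ∧ z ≤ R then
    if (n : ℤ) ≤ 2 * (R + 1 - z) then min (z + n - 1) M else z - 1
  else R

/-- The left end of an interval of opinion `1`, cut off at `-M`, after the update of the block
starting at `z`: the mirror image of `rightEnd`. -/
def leftEnd (n M : ℕ) (L z : ℤ) : ℤ := -rightEnd n M (-L) (-(z + n - 1))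

section Drift

variable {m : ℕ} {θ γ : ℝ}

lemma sum_exp_rightEnd_le (hm : 0 < m)
    (hdrift : ∑ l ∈ Finset.range (m - 1), (Real.exp (θ * (l + 1)) - 1) +
      ∑ j ∈ Finset.range m, (Real.exp (-(θ * (j + 1))) - 1) ≤ -γ)
    (M : ℕ) (R : ℤ) (W : Finset ℤ) (hW : Finset.Ioc (R + 1 - (2 * m : ℕ)) R ⊆ W) :
    ∑ z ∈ W, Real.exp (-(θ * (rightEnd (2 * m) M R z : ℝ))) ≤
      (W.card - γ) * Real.exp (-(θ * R)) + m * Real.exp (-(θ * M)) := by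
  have h1 : ∑ z ∈ W, (Real.exp (-(θ * (rightEnd (2 * m) M R z : ℝ))) - Real.exp (-(θ * R))) =
      ∑ z ∈ Finset.Ioc (R + 1 - (2 * m : ℕ)) R,
        (Real.exp (-(θ * (rightEnd (2 * m) M R z : ℝ))) - Real.exp (-(θ * R))) := by
    refine (Finset.sum_subset hW fun z _ hz => ?_).symm
    rw [Finset.mem_Ioc] at hz
    rw [rightEnd, if_neg hz, sub_self]
  have h2 : ∑ z ∈ Finset.Ioc (R + 1 - (2 * m : ℕ)) R,
        (Real.exp (-(θ * (rightEnd (2 * m) M R z : ℝ))) - Real.exp (-(θ * R))) =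
      ∑ l ∈ Finset.range ((m - 1) + m),
        (Real.exp (-(θ * (rightEnd (2 * m) M R (R - l) : ℝ))) - Real.exp (-(θ * R))) := by
    refine (Finset.sum_bij (fun (l : ℕ) _ => R - (l : ℤ)) ?_ ?_ ?_ ?_).symm
    · intro l hl
      rw [Finset.mem_range] at hl
      rw [Finset.mem_Ioc]
      push_cast
      omega
    · intro a _ b _ h
      omega
    · intro z hz
      rw [Finset.mem_Ioc] at hz
      push_cast at hz
      exact ⟨(R - z).toNat, by rw [Finset.mem_range]; omega, by omega⟩
    · exact fun _ _ => rfl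
  have h3 : ∀ l ∈ Finset.range (m - 1),
      Real.exp (-(θ * (rightEnd (2 * m) M R (R - l) : ℝ))) - Real.exp (-(θ * R)) =
        Real.exp (-(θ * R)) * (Real.exp (θ * (l + 1)) - 1) := by
    intro l hl
    rw [Finset.mem_range] at hl
    rw [rightEnd, if_pos (by push_cast; omega), if_neg (by push_cast; omega), mul_sub, mul_one,
      ← Real.exp_add]
    congr 2
    push_cast
    ring
  have h4 : ∀ j ∈ Finset.range m,
      Real.exp (-(θ * (rightEnd (2 * m) M R (R - (m - 1 + j : ℕ)) : ℝ))) - Real.exp (-(θ * R)) ≤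
        Real.exp (-(θ * R)) * (Real.exp (-(θ * ((m - 1 - j : ℕ) + 1))) - 1) +
          Real.exp (-(θ * M)) := by
    intro j hj
    rw [Finset.mem_range] at hj
    rw [rightEnd, if_pos (by push_cast; omega), if_pos (by push_cast; omega), mul_sub, mul_one,
      ← Real.exp_add]
    rcases min_choice (R - (m - 1 + j : ℕ) + (2 * m : ℕ) - 1) (M : ℤ) with h | h
    · rw [h]
      have : (R - (m - 1 + j : ℕ) + (2 * m : ℕ) - 1 : ℤ) = R + ((m - 1 - j : ℕ) + 1) := by
        omega
      rw [this]
      have h0 := (Real.exp_pos (-(θ * M))).le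
      have h5 : -(θ * ((R + ((m - 1 - j : ℕ) + 1) : ℤ) : ℝ)) =
          -(θ * R) + -(θ * ((m - 1 - j : ℕ) + 1)) := by
        push_cast; ring
      rw [h5]
      linarith
    · rw [h]
      have h0 := (Real.exp_pos (-(θ * R) + -(θ * ((m - 1 - j : ℕ) + 1)))).le
      push_cast at h0 ⊢
      linarith
  have h5 : ∑ z ∈ W, (Real.exp (-(θ * (rightEnd (2 * m) M R z : ℝ))) - Real.exp (-(θ * R))) ≤
      -γ * Real.exp (-(θ * R)) + m * Real.exp (-(θ * M)) := by
    rw [h1, h2, Finset.sum_range_add, Finset.sum_congr rfl h3, ← Finset.mul_sum]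
    refine (add_le_add_right (Finset.sum_le_sum h4) _).trans ?_
    rw [Finset.sum_add_distrib, ← Finset.mul_sum,
      Finset.sum_range_reflect (fun j : ℕ => Real.exp (-(θ * ((j : ℝ) + 1))) - 1) m]
    have := mul_le_mul_of_nonneg_left hdrift (Real.exp_pos (-(θ * R))).le
    simp only [Finset.sum_const, Finset.card_range, nsmul_eq_mul]
    linarith
  rw [Finset.sum_sub_distrib, Finset.sum_const, nsmul_eq_mul] at h5
  linarith

variable (hm : 0 < m)
  (hdrift : ∑ l ∈ Finset.range (m - 1), (Real.exp (θ * (l + 1)) - 1) +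
    ∑ j ∈ Finset.range m, (Real.exp (-(θ * (j + 1))) - 1) ≤ -γ)
include hm hdrift

lemma sum_windowSite_exp_rightEnd_le {M : ℕ} {R : ℤ} (h1 : -(M : ℤ) ≤ R) (h2 : R ≤ M) :
    ∑ i, Real.exp (-(θ * (rightEnd (2 * m) M R (windowSite (2 * m) M i) : ℝ))) ≤
      ((2 * M + 2 * m + 1 : ℕ) - γ) * Real.exp (-(θ * R)) + m * Real.exp (-(θ * M)) := by
  rw [sum_windowSite fun z => Real.exp (-(θ * (rightEnd (2 * m) M R z : ℝ)))]
  have hc : (Finset.Icc (-(M : ℤ) - (2 * m : ℕ)) M).card = 2 * M + 2 * m + 1 := by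
    rw [Int.card_Icc]; omega
  rw [← hc]
  refine sum_exp_rightEnd_le hm hdrift M R _ fun z hz => ?_
  rw [Finset.mem_Ioc] at hz
  rw [Finset.mem_Icc]
  omega

lemma sum_windowSite_exp_leftEnd_le {M : ℕ} {L : ℤ} (h1 : -(M : ℤ) ≤ L) (h2 : L ≤ M) :
    ∑ i, Real.exp (θ * (leftEnd (2 * m) M L (windowSite (2 * m) M i) : ℝ)) ≤
      ((2 * M + 2 * m + 1 : ℕ) - γ) * Real.exp (θ * L) + m * Real.exp (-(θ * M)) := by
  rw [sum_windowSite fun z => Real.exp (θ * (leftEnd (2 * m) M L z : ℝ))]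
  have hc : (Finset.Icc (-(M : ℤ) - (2 * m : ℕ)) M).card = 2 * M + 2 * m + 1 := by
    rw [Int.card_Icc]; omega
  have hinj : Function.Injective fun z : ℤ => -(z + (2 * m : ℕ) - 1) := fun a b h => by
    simp only [neg_inj] at h
    omega
  have h := sum_exp_rightEnd_le hm hdrift M (-L)
    ((Finset.Icc (-(M : ℤ) - (2 * m : ℕ)) M).image fun z => -(z + (2 * m : ℕ) - 1)) ?_
  · rw [Finset.sum_image hinj.injOn, Finset.card_image_of_injective _ hinj, hc] at h
    convert h using 4 <;> simp [leftEnd]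
  · intro z hz
    rw [Finset.mem_Ioc] at hz
    rw [Finset.mem_image]
    exact ⟨-(z + (2 * m : ℕ) - 1), by rw [Finset.mem_Icc]; omega, by omega⟩

omit hm hdrift

lemma majorityOne_of_Icc_subset {n : ℕ} {z c d : ℤ} {ζ : Set ℤ} (hζ : Set.Icc c d ⊆ ζ) (hc : z ≤ c)
    (hd : d < z + n) (h : (n : ℤ) ≤ 2 * (d + 1 - c)) : MajorityOne (block n z) ζ := by
  have hle : ((Finset.Icc c d : Finset ℤ) : Set ℤ).ncard ≤ (ζ ∩ (block n z : Set ℤ)).ncard := by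
    refine Set.ncard_le_ncard ?_ ((block n z).finite_toSet.inter_of_right _)
    rw [Finset.coe_Icc]
    intro w hw
    exact ⟨hζ hw, mem_block.2 ⟨hc.trans hw.1, lt_of_le_of_lt hw.2 hd⟩⟩
  rw [Set.ncard_coe_finset, Int.card_Icc] at hle
  rw [MajorityOne, card_block]
  omega

lemma rightEnd_le {n M : ℕ} {R : ℤ} (hR : R ≤ M) (z : ℤ) : rightEnd n M R z ≤ M := by
  unfold rightEnd
  split_ifs
  · exact min_le_right _ _
  · omega
  · exact hR

lemma neg_le_leftEnd {n M : ℕ} {L : ℤ} (hL : -(M : ℤ) ≤ L) (z : ℤ) : -(M : ℤ) ≤ leftEnd n M L z := by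
  have := rightEnd_le (n := n) (M := M) (R := -L) (by omega) (-(z + n - 1))
  unfold leftEnd
  omega

/-- An interval longer than two blocks remains an interval, with at most one end displaced. -/
lemma Icc_leftEnd_rightEnd_subset {n M : ℕ} {L R : ℤ} (hL : -(M : ℤ) ≤ L) (hR : R ≤ M)
    (hLR : 2 * (n : ℤ) ≤ R - L) {ζ : Set ℤ} (hζ : Set.Icc L R ⊆ ζ) (z : ℤ) :
    Set.Icc (leftEnd n M L z) (rightEnd n M R z) ⊆ windowUpdate n M z ζ := by
  rintro w ⟨hw1, hw2⟩
  refine ⟨?_, (neg_le_leftEnd hL z).trans hw1, hw2.trans (rightEnd_le hR z)⟩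
  unfold leftEnd rightEnd at hw1
  unfold rightEnd at hw2
  by_cases hr : R + 1 - n < z ∧ z ≤ R
  · rw [if_pos hr] at hw2
    rw [if_neg (by omega)] at hw1
    by_cases hk : (n : ℤ) ≤ 2 * (R + 1 - z)
    · rw [if_pos hk, le_min_iff] at hw2
      have hmaj : MajorityOne (block n z) ζ := majorityOne_of_Icc_subset (c := z) (d := R)
        (fun v hv => hζ ⟨by have := hv.1; omega, hv.2⟩) le_rfl (by omega) hk
      refine hmaj.mem_majorityUpdate ?_
      by_cases hwz : z ≤ w
      · exact Or.inl (mem_block.2 ⟨hwz, by omega⟩)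
      · exact Or.inr (hζ ⟨by omega, by omega⟩)
    · rw [if_neg hk] at hw2
      exact mem_majorityUpdate_of_notMem (fun h => by have := mem_block.1 h; omega)
        (hζ ⟨by omega, by omega⟩)
  · rw [if_neg hr] at hw2
    by_cases hl : z < L ∧ L ≤ z + n - 1
    · rw [if_pos (by omega)] at hw1
      by_cases hk : (n : ℤ) ≤ 2 * (z + n - L)
      · rw [if_pos (by omega)] at hw1
        have hmaj : MajorityOne (block n z) ζ := majorityOne_of_Icc_subset (c := L) (d := z + n - 1)
          (fun v hv => hζ ⟨hv.1, by have := hv.2; omega⟩) hl.1.le (by omega) (by omega)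
        refine hmaj.mem_majorityUpdate ?_
        by_cases hwz : w < z + n
        · refine Or.inl (mem_block.2 ⟨?_, hwz⟩)
          have := min_le_left (-(z + n - 1) + n - 1) (M : ℤ)
          omega
        · exact Or.inr (hζ ⟨by omega, by omega⟩)
      · rw [if_neg (by omega)] at hw1
        exact mem_majorityUpdate_of_notMem (fun h => by have := mem_block.1 h; omega)
          (hζ ⟨by omega, by omega⟩)
    · rw [if_neg (by omega)] at hw1
      have hwζ : w ∈ ζ := hζ ⟨by omega, by omega⟩
      by_cases hin : w ∈ block n z
      · have hin' := mem_block.1 hin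
        have hmaj : MajorityOne (block n z) ζ := majorityOne_of_Icc_subset (c := z) (d := z + n - 1)
          (fun v hv => hζ ⟨by have := hv.1; omega, by have := hv.2; omega⟩) le_rfl (by omega)
          (by omega)
        exact hmaj.mem_majorityUpdate (Or.inl hin)
      · exact mem_majorityUpdate_of_notMem hin hwζ

include hm hdrift

/-- From an interval `[L, R]` of opinion `1`, the first two terms control the event that one of its
ends ever comes within a distance `n` of `c`, and the last two the time needed to reach `x`. The
constant `D` accounts for the boundary of the window. -/
lemma badBound_of_Icc_subset (hθ : 0 < θ) (hγ : 0 < γ) {M : ℕ} {c x : ℤ} {D : ℝ}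
    (hD : m * Real.exp (-(θ * M)) * (Real.exp (θ * (c + (2 * m : ℕ))) + Real.exp (θ * ((2 * m : ℕ) - c))
      + Real.exp (θ * x) + Real.exp (-(θ * x))) ≤ D) (k : ℕ) (L R : ℤ) (hLM : -(M : ℤ) ≤ L)
    (hRM : R ≤ M) (ζ : Set ℤ) (hζ : Set.Icc L R ⊆ ζ) :
    BadBound (fun i => windowUpdate (2 * m) M (windowSite (2 * m) M i)) (fun ζ => x ∉ ζ) γ D k ζ
      (Real.exp (θ * (c + (2 * m : ℕ))) * Real.exp (-(θ * R)) +
        Real.exp (θ * ((2 * m : ℕ) - c)) * Real.exp (θ * L))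
      (Real.exp (θ * x) * Real.exp (-(θ * R)) + Real.exp (-(θ * x)) * Real.exp (θ * L)) := by
  have hD0 : 0 ≤ D := le_trans (by positivity) hD
  induction k generalizing L R ζ with
  | zero => exact badBound_zero hD0 (by positivity) (by positivity)
  | succ k ih =>
    by_cases hR : R < c + (2 * m : ℕ)
    · refine badBound_of_one_le hD0 ?_ (by positivity)
      have h1 : 1 ≤ Real.exp (θ * (c + (2 * m : ℕ))) * Real.exp (-(θ * R)) := by
        rw [← Real.exp_add]
        refine Real.one_le_exp ?_
        have : (R : ℝ) ≤ c + (2 * m : ℕ) := by exact_mod_cast hR.le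
        nlinarith
      have h2 : 0 ≤ Real.exp (θ * ((2 * m : ℕ) - c)) * Real.exp (θ * L) := by positivity
      linarith
    by_cases hL : c - (2 * m : ℕ) < L
    · refine badBound_of_one_le hD0 ?_ (by positivity)
      have h1 : 1 ≤ Real.exp (θ * ((2 * m : ℕ) - c)) * Real.exp (θ * L) := by
        rw [← Real.exp_add]
        refine Real.one_le_exp ?_
        have : (c : ℝ) - (2 * m : ℕ) ≤ L := by exact_mod_cast hL.le
        nlinarith
      have h2 : 0 ≤ Real.exp (θ * (c + (2 * m : ℕ))) * Real.exp (-(θ * R)) := by positivity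
      linarith
    push Not at hR hL
    have hsR := sum_windowSite_exp_rightEnd_le hm hdrift (M := M) (R := R) (by omega) hRM
    have hsL := sum_windowSite_exp_leftEnd_le hm hdrift (M := M) (L := L) hLM (by omega)
    have hpos : ∀ p p' r l : ℝ, 0 ≤ Real.exp p * Real.exp r + Real.exp p' * Real.exp l :=
      fun _ _ _ _ => by positivity
    refine BadBound.step hγ.le (hpos _ _ _ _) (hpos _ _ _ _) (fun i => hpos _ _ _ _)
      (fun i => hpos _ _ _ _)
      (D₁ := m * Real.exp (-(θ * M)) *
        (Real.exp (θ * (c + (2 * m : ℕ))) + Real.exp (θ * ((2 * m : ℕ) - c))))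
      (D₂ := m * Real.exp (-(θ * M)) * (Real.exp (θ * x) + Real.exp (-(θ * x)))) (by positivity)
      (by linarith) hD0
      (fun i => ih (leftEnd (2 * m) M L (windowSite (2 * m) M i))
        (rightEnd (2 * m) M R (windowSite (2 * m) M i)) (neg_le_leftEnd hLM _) (rightEnd_le hRM _) _
        (Icc_leftEnd_rightEnd_subset hLM hRM (by push_cast at hR hL ⊢; omega) hζ _)) ?_ ?_ ?_
    · rw [Finset.sum_add_distrib, ← Finset.mul_sum, ← Finset.mul_sum]
      have h1 := mul_le_mul_of_nonneg_left hsR (Real.exp_pos (θ * (c + (2 * m : ℕ)))).le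
      have h2 := mul_le_mul_of_nonneg_left hsL (Real.exp_pos (θ * ((2 * m : ℕ) - c))).le
      have h3 := mul_nonneg hγ.le (hpos (θ * (c + (2 * m : ℕ))) (θ * ((2 * m : ℕ) - c))
        (-(θ * R)) (θ * L))
      linarith
    · rw [Finset.sum_add_distrib, ← Finset.mul_sum, ← Finset.mul_sum]
      have h1 := mul_le_mul_of_nonneg_left hsR (Real.exp_pos (θ * x)).le
      have h2 := mul_le_mul_of_nonneg_left hsL (Real.exp_pos (-(θ * x))).le
      linarith
    · intro hx
      have h0 := hpos (θ * (c + (2 * m : ℕ))) (θ * ((2 * m : ℕ) - c)) (-(θ * R)) (θ * L)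
      by_cases hxR : R < x
      · have h1 : 1 ≤ Real.exp (θ * x) * Real.exp (-(θ * R)) := by
          rw [← Real.exp_add]
          refine Real.one_le_exp ?_
          have : (R : ℝ) ≤ x := by exact_mod_cast hxR.le
          nlinarith
        have h2 : 0 ≤ Real.exp (-(θ * x)) * Real.exp (θ * L) := by positivity
        linarith
      · have hxL : x < L := by
          by_contra hxL
          exact hx (hζ ⟨not_lt.1 hxL, not_lt.1 hxR⟩)
        have h1 : 1 ≤ Real.exp (-(θ * x)) * Real.exp (θ * L) := by
          rw [← Real.exp_add]
          refine Real.one_le_exp ?_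
          have : (x : ℝ) ≤ L := by exact_mod_cast hxL.le
          nlinarith
        have h2 : 0 ≤ Real.exp (θ * x) * Real.exp (-(θ * R)) := by positivity
        linarith

end Drift

/-! ### Independent attempts to create a long interval of opinion `1` -/

lemma MajorityOne.of_inter_subset {V : Type*} {h : Finset V} {η η' : Set V}
    (hm : MajorityOne h η) (hh : η ∩ h ⊆ η') : MajorityOne h η' := by
  have h1 : MajorityOne h (η ∩ h) := by
    unfold MajorityOne at hm ⊢
    rwa [Set.inter_assoc, Set.inter_self]
  exact h1.mono hh

/-- The stage of the attempt at `y` after a ring at `z`. The attempt at stage `some j` reaches stage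
`some (j + 1)` at a ring of `y + j`, fails, in stage `none`, at any other ring whose block may meet
the vertices `y, …, y + n + K - 2` of the attempt, and ignores the remaining rings. -/
noncomputable def nextStage (n K : ℕ) (y z : ℤ) (o : Option ℕ) : Option ℕ :=
  if z ∈ Finset.Icc (y - n + 1) (y + n + K - 2) then
    o.bind fun j => if z = y + j then some (j + 1) else none
  else o

/-- What the attempt at `y` guarantees about the configuration: the interval of opinion `1` that it
has created, which at stage `some 0` is only a majority in the block starting at `y`. -/
def StageHolds (n : ℕ) (ζ : Set ℤ) (y : ℤ) : Option ℕ → Prop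
  | none => True
  | some 0 => MajorityOne (block n y) ζ
  | some (j + 1) => Set.Icc y (y + n + j - 1) ⊆ ζ

/-- The probability that the attempt reaches stage `some K`, where `q` is the probability of
reaching the next stage. -/
noncomputable def stageWeight (q : ℝ) (K : ℕ) : Option ℕ → ℝ
  | none => 0
  | some j => q ^ (K - j)

/-- The indicator that the attempt has not failed. -/
def aliveIndicator : Option ℕ → ℝ
  | none => 0
  | some _ => 1

lemma stageHolds_windowUpdate {n M K : ℕ} (hn : 2 ≤ n) {y : ℤ} {ζ : Set ℤ} (h1 : -(M : ℤ) ≤ y)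
    (h2 : y + n + K - 2 ≤ M) (z : ℤ) {o : Option ℕ} (ho : StageHolds n ζ y o)
    (hK : ∀ j, o = some j → j < K) : StageHolds n (windowUpdate n M z ζ) y (nextStage n K y z o) := by
  cases o with
  | none => unfold nextStage; split_ifs <;> trivial
  | some j =>
    have hjK := hK j rfl
    by_cases hz : z ∈ Finset.Icc (y - n + 1) (y + n + K - 2)
    · rw [nextStage, if_pos hz, Option.bind_some]
      by_cases hzj : z = y + j
      · rw [if_pos hzj]
        rintro w ⟨hw1, hw2⟩
        refine ⟨?_, by omega, by omega⟩
        cases j with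
        | zero =>
          have hm : MajorityOne (block n z) ζ := by rw [hzj]; simpa [StageHolds] using ho
          exact hm.mem_majorityUpdate (Or.inl (mem_block.2 ⟨by omega, by omega⟩))
        | succ j =>
          have ho' : Set.Icc y (y + n + j - 1) ⊆ ζ := ho
          -- all the vertices of the block but the last one hold opinion `1`
          have hm : MajorityOne (block n z) ζ :=
            majorityOne_of_Icc_subset (c := z) (d := y + n + j - 1)
              (fun v hv => ho' ⟨by have := hv.1; omega, hv.2⟩) le_rfl (by omega) (by omega)
          refine hm.mem_majorityUpdate ?_
          by_cases hwz : z ≤ w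
          · exact Or.inl (mem_block.2 ⟨hwz, by omega⟩)
          · exact Or.inr (ho' ⟨hw1, by omega⟩)
      · rw [if_neg hzj]
        trivial
    · rw [nextStage, if_neg hz]
      rw [Finset.mem_Icc] at hz
      have hstay : ∀ w ∈ ζ, y ≤ w → w ≤ y + n + K - 2 → w ∈ windowUpdate n M z ζ := by
        intro w hw hw1 hw2
        exact ⟨mem_majorityUpdate_of_notMem (fun h => by have := mem_block.1 h; omega) hw,
          by omega, by omega⟩
      cases j with
      | zero =>
        refine MajorityOne.of_inter_subset ho ?_
        rintro w ⟨hw, hwb⟩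
        have := mem_block.1 (Finset.mem_coe.1 hwb)
        exact hstay w hw this.1 (by omega)
      | succ j =>
        intro w hw
        exact hstay w (ho hw) hw.1 (by have := hw.2; omega)

lemma nextStage_le {n K : ℕ} {y z : ℤ} {o : Option ℕ} (hK : ∀ j, o = some j → j < K) (j : ℕ)
    (hj : nextStage n K y z o = some j) : j ≤ K := by
  cases o with
  | none => simp [nextStage] at hj
  | some i =>
    have hi := hK i rfl
    unfold nextStage at hj
    split_ifs at hj with h1
    · rw [Option.bind_some] at hj
      split_ifs at hj with h2
      simp only [Option.some.injEq] at hj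
      omega
    · simp only [Option.some.injEq] at hj
      omega

section Attempt

variable {n K : ℕ} (hn : 2 ≤ n) (hK : 0 < K) {y : ℤ} {W : Finset ℤ}
  (hW : Finset.Icc (y - n + 1) (y + n + K - 2) ⊆ W) {o : Option ℕ} (ho : ∀ j, o = some j → j < K)
include hn hK hW ho

lemma sum_nextStage_sub (f : Option ℕ → ℝ) : ∑ z ∈ W, (f (nextStage n K y z o) - f o) =
    o.elim 0 fun j => f (some (j + 1)) + (2 * n + K - 3 : ℕ) * f none -
      (2 * n + K - 2 : ℕ) * f (some j) := by
  have h1 : ∑ z ∈ W, (f (nextStage n K y z o) - f o) =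
      ∑ z ∈ Finset.Icc (y - n + 1) (y + n + K - 2), (f (nextStage n K y z o) - f o) := by
    refine (Finset.sum_subset hW fun z _ hz => ?_).symm
    rw [nextStage, if_neg hz, sub_self]
  have hcard : (Finset.Icc (y - n + 1) (y + n + K - 2)).card = 2 * n + K - 2 := by
    rw [Int.card_Icc]; omega
  rw [h1]
  cases o with
  | none =>
    refine Finset.sum_eq_zero fun z hz => ?_
    rw [nextStage, if_pos hz, Option.bind_none, sub_self]
  | some j =>
    have hj := ho j rfl
    have hmem : y + j ∈ Finset.Icc (y - n + 1) (y + n + K - 2) := by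
      rw [Finset.mem_Icc]; omega
    have h2 : ∀ z ∈ Finset.Icc (y - n + 1) (y + n + K - 2),
        f (nextStage n K y z (some j)) - f (some j) =
          (if z = y + j then f (some (j + 1)) - f none else 0) + (f none - f (some j)) := by
      intro z hz
      rw [nextStage, if_pos hz, Option.bind_some]
      split_ifs <;> ring
    rw [Finset.sum_congr rfl h2, Finset.sum_add_distrib, Finset.sum_ite_eq', if_pos hmem,
      Finset.sum_const, hcard, nsmul_eq_mul, Option.elim_some,
      show 2 * n + K - 2 = (2 * n + K - 3) + 1 by omega]
    push_cast
    ring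

lemma sum_stageWeight_nextStage_sub :
    ∑ z ∈ W, (stageWeight (1 / (2 * n + K - 2 : ℕ)) K (nextStage n K y z o) -
      stageWeight (1 / (2 * n + K - 2 : ℕ)) K o) = 0 := by
  rw [sum_nextStage_sub hn hK hW ho]
  cases o with
  | none => rfl
  | some j =>
    have hj := ho j rfl
    have h0 : ((2 * n + K - 2 : ℕ) : ℝ) ≠ 0 := by
      rw [Nat.cast_ne_zero]; omega
    simp only [Option.elim_some, stageWeight]
    rw [show K - j = K - (j + 1) + 1 by omega, pow_succ]
    field_simp
    ring

lemma sum_aliveIndicator_nextStage_le {γ : ℝ} (hγ : γ ≤ 1) :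
    ∑ z ∈ W, aliveIndicator (nextStage n K y z o) ≤ (W.card - γ) * aliveIndicator o := by
  have h := sum_nextStage_sub hn hK hW ho aliveIndicator
  rw [Finset.sum_sub_distrib, Finset.sum_const, nsmul_eq_mul] at h
  cases o with
  | none =>
    simp only [Option.elim_none, aliveIndicator] at h ⊢
    linarith
  | some j =>
    simp only [Option.elim_some, aliveIndicator] at h ⊢
    have : (2 : ℝ) ≤ (2 * n + K - 2 : ℕ) := by exact_mod_cast (by omega : 2 ≤ 2 * n + K - 2)
    linarith

end Attempt

lemma prod_eq_prod_add_sum_erase {ι : Type*} [DecidableEq ι] {Y : Finset ι} {f g : ι → ℝ}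
    (h : ∀ y ∈ Y, ∀ y' ∈ Y, g y ≠ f y → g y' ≠ f y' → y = y') :
    ∏ y ∈ Y, g y = ∏ y ∈ Y, f y + ∑ y ∈ Y, (g y - f y) * ∏ y' ∈ Y.erase y, f y' := by
  by_cases hex : ∃ y ∈ Y, g y ≠ f y
  · obtain ⟨y, hy, hne⟩ := hex
    have heq : ∀ y' ∈ Y, y' ≠ y → g y' = f y' := fun y' hy' hyy => by
      by_contra hc
      exact hyy (h y' hy' y hy hc hne)
    rw [Finset.sum_eq_single_of_mem y hy fun y' hy' hyy => by rw [heq y' hy' hyy, sub_self, zero_mul],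
      ← Finset.mul_prod_erase Y g hy, ← Finset.mul_prod_erase Y f hy,
      Finset.prod_congr rfl fun y' hy' => heq y' (Finset.mem_of_mem_erase hy')
        (Finset.ne_of_mem_erase hy')]
    ring
  · push Not at hex
    rw [Finset.prod_congr rfl hex, Finset.sum_eq_zero fun y hy => by rw [hex y hy, sub_self, zero_mul],
      add_zero]

/-- The probability that all the attempts fail is preserved on average: the attempts at distant sites
use disjoint sets of clocks. -/
lemma sum_prod_stageWeight {n K : ℕ} (hn : 2 ≤ n) (hK : 0 < K) {W Y : Finset ℤ}
    (hW : ∀ y ∈ Y, Finset.Icc (y - n + 1) (y + n + K - 2) ⊆ W)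
    (hsep : ∀ y ∈ Y, ∀ y' ∈ Y, y ≠ y' → (2 * n + K : ℤ) ≤ |y - y'|) {α : ℤ → Option ℕ}
    (hα : ∀ y ∈ Y, ∀ j, α y = some j → j < K) :
    ∑ z ∈ W, ∏ y ∈ Y, (1 - stageWeight (1 / (2 * n + K - 2 : ℕ)) K (nextStage n K y z (α y))) =
      W.card * ∏ y ∈ Y, (1 - stageWeight (1 / (2 * n + K - 2 : ℕ)) K (α y)) := by
  set w := stageWeight (1 / (2 * n + K - 2 : ℕ)) K with hw
  have h1 : ∀ z, ∏ y ∈ Y, (1 - w (nextStage n K y z (α y))) = ∏ y ∈ Y, (1 - w (α y)) +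
      ∑ y ∈ Y, ((1 - w (nextStage n K y z (α y))) - (1 - w (α y))) *
        ∏ y' ∈ Y.erase y, (1 - w (α y')) := by
    intro z
    refine prod_eq_prod_add_sum_erase fun y hy y' hy' hne hne' => ?_
    by_contra hyy
    have hz : ∀ v, 1 - w (nextStage n K v z (α v)) ≠ 1 - w (α v) →
        z ∈ Finset.Icc (v - n + 1) (v + n + K - 2) := fun v hv => by
      by_contra hc
      exact hv (by rw [nextStage, if_neg hc])
    have h1 := Finset.mem_Icc.1 (hz y hne)
    have h2 := Finset.mem_Icc.1 (hz y' hne')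
    have h3 := hsep y hy y' hy' hyy
    rcases abs_cases (y - y') with h | h <;> omega
  rw [Finset.sum_congr rfl fun z _ => h1 z, Finset.sum_add_distrib, Finset.sum_const, nsmul_eq_mul,
    Finset.sum_comm, add_eq_left]
  refine Finset.sum_eq_zero fun y hy => ?_
  rw [← Finset.sum_mul]
  have h2 := sum_stageWeight_nextStage_sub hn hK (hW y hy) (hα y hy)
  have h3 : ∑ z ∈ W, ((1 - w (nextStage n K y z (α y))) - (1 - w (α y))) =
      -∑ z ∈ W, (w (nextStage n K y z (α y)) - w (α y)) := by
    rw [← Finset.sum_neg_distrib]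
    exact Finset.sum_congr rfl fun z _ => by ring
  rw [h3, h2, neg_zero, zero_mul]

lemma stageWeight_le_one {q : ℝ} (hq : 0 ≤ q) (hq1 : q ≤ 1) (K : ℕ) (o : Option ℕ) :
    stageWeight q K o ≤ 1 := by
  cases o with
  | none => exact zero_le_one
  | some j => exact pow_le_one₀ hq hq1

lemma aliveIndicator_nonneg (o : Option ℕ) : 0 ≤ aliveIndicator o := by
  cases o with
  | none => exact le_rfl
  | some j => exact zero_le_one

/-- If every attempt that succeeds gives the bound `a + b exp (-γ t)`, then it is enough to add the
probability that all the attempts fail. -/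
lemma badBound_of_stageHolds {n M K : ℕ} (hn : 2 ≤ n) (hK : 0 < K) {x : ℤ} {γ D a b : ℝ}
    (hγ : 0 < γ) (hγ1 : γ ≤ 1) (hD : 0 ≤ D) (ha : 0 ≤ a) (hb : 1 ≤ b) {Y : Finset ℤ}
    (hYM : ∀ y ∈ Y, -(M : ℤ) ≤ y ∧ y + n + K - 2 ≤ M)
    (hsep : ∀ y ∈ Y, ∀ y' ∈ Y, y ≠ y' → (2 * n + K : ℤ) ≤ |y - y'|)
    (hlong : ∀ k, ∀ y ∈ Y, ∀ ζ : Set ℤ, Set.Icc y (y + n + K - 2) ⊆ ζ →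
      BadBound (fun i => windowUpdate n M (windowSite n M i)) (fun ζ => x ∉ ζ) γ D k ζ a b)
    (k : ℕ) (α : ℤ → Option ℕ) (hα : ∀ y ∈ Y, ∀ j, α y = some j → j ≤ K) (ζ : Set ℤ)
    (hζ : ∀ y ∈ Y, StageHolds n ζ y (α y)) :
    BadBound (fun i => windowUpdate n M (windowSite n M i)) (fun ζ => x ∉ ζ) γ D k ζ
      (∏ y ∈ Y, (1 - stageWeight (1 / (2 * n + K - 2 : ℕ)) K (α y)) + a)
      (b * ∑ y ∈ Y, aliveIndicator (α y)) := by
  set q : ℝ := 1 / (2 * n + K - 2 : ℕ) with hq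
  have hq0 : 0 ≤ q := by positivity
  have hq1 : q ≤ 1 := by
    have : (1 : ℝ) ≤ (2 * n + K - 2 : ℕ) := by exact_mod_cast (by omega : 1 ≤ 2 * n + K - 2)
    exact (div_le_one (by linarith)).2 this
  have hF : ∀ α : ℤ → Option ℕ, 0 ≤ ∏ y ∈ Y, (1 - stageWeight q K (α y)) := fun α =>
    Finset.prod_nonneg fun y _ => sub_nonneg.2 (stageWeight_le_one hq0 hq1 K _)
  have hS : ∀ α : ℤ → Option ℕ, 0 ≤ b * ∑ y ∈ Y, aliveIndicator (α y) := fun α =>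
    mul_nonneg (by linarith) (Finset.sum_nonneg fun y _ => aliveIndicator_nonneg _)
  have hSone : ∀ α : ℤ → Option ℕ, ∀ y ∈ Y, ∀ j, α y = some j →
      b ≤ b * ∑ y ∈ Y, aliveIndicator (α y) := by
    intro α y hy j hj
    have h1 := Finset.single_le_sum (f := fun y => aliveIndicator (α y))
      (fun y _ => aliveIndicator_nonneg _) hy
    have h2 : aliveIndicator (α y) = 1 := by rw [hj]; rfl
    have h3 : 1 ≤ ∑ y ∈ Y, aliveIndicator (α y) := h2 ▸ h1
    nlinarith
  induction k generalizing α ζ with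
  | zero => exact badBound_zero hD (add_nonneg (hF α) ha) (hS α)
  | succ k ih =>
    by_cases hdone : ∃ y ∈ Y, α y = some K
    · obtain ⟨y, hy, hyK⟩ := hdone
      have hI : Set.Icc y (y + n + K - 2) ⊆ ζ := by
        have h1 := hζ y hy
        obtain ⟨K', rfl⟩ : ∃ K', K = K' + 1 := ⟨K - 1, by omega⟩
        rw [hyK] at h1
        have h2 : Set.Icc y (y + n + K' - 1) ⊆ ζ := h1
        intro v hv
        have := hv.2
        push_cast at this
        exact h2 ⟨hv.1, by omega⟩
      exact (hlong (k + 1) y hy ζ hI).mono (by linarith [hF α]) (hSone α y hy K hyK)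
    · have hlt : ∀ y ∈ Y, ∀ j, α y = some j → j < K := fun y hy j hj =>
        lt_of_le_of_ne (hα y hy j hj) fun hjK => hdone ⟨y, hy, by rw [hj, hjK]⟩
      have hW : ∀ y ∈ Y, Finset.Icc (y - n + 1) (y + n + K - 2) ⊆ Finset.Icc (-(M : ℤ) - n) M := by
        intro y hy z hz
        have := hYM y hy
        rw [Finset.mem_Icc] at hz ⊢
        omega
      have hc : (Finset.Icc (-(M : ℤ) - n) M).card = 2 * M + n + 1 := by
        rw [Int.card_Icc]; omega
      refine BadBound.step hγ.le (add_nonneg (hF α) ha) (hS α)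
        (A := fun i => ∏ y ∈ Y, (1 - stageWeight q K (nextStage n K y (windowSite n M i) (α y))) + a)
        (B := fun i => b * ∑ y ∈ Y, aliveIndicator (nextStage n K y (windowSite n M i) (α y)))
        (D₁ := 0) (D₂ := 0) (fun i => add_nonneg (hF _) ha) (fun i => hS _) le_rfl (by linarith) hD
        (fun i => ih (fun y => nextStage n K y (windowSite n M i) (α y))
          (fun y hy => nextStage_le (hlt y hy)) _
          (fun y hy => stageHolds_windowUpdate hn (hYM y hy).1 (hYM y hy).2 _ (hζ y hy) (hlt y hy)))
        ?_ ?_ ?_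
      · rw [sum_windowSite fun z => ∏ y ∈ Y, (1 - stageWeight q K (nextStage n K y z (α y))) + a,
          Finset.sum_add_distrib, sum_prod_stageWeight hn hK hW hsep hlt, Finset.sum_const,
          nsmul_eq_mul, hc]
        linarith
      · rw [← Finset.mul_sum,
          sum_windowSite fun z => ∑ y ∈ Y, aliveIndicator (nextStage n K y z (α y)),
          Finset.sum_comm, add_zero, mul_left_comm, Finset.mul_sum (a := _ - γ), ← hc]
        exact mul_le_mul_of_nonneg_left (Finset.sum_le_sum fun y hy =>
          sum_aliveIndicator_nextStage_le hn hK (hW y hy) (hlt y hy) hγ1) (by linarith)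
      · intro _
        by_cases halive : ∃ y ∈ Y, ∃ j, α y = some j
        · obtain ⟨y, hy, j, hj⟩ := halive
          have := hSone α y hy j hj
          have := hF α
          linarith
        · push Not at halive
          have h1 : ∏ y ∈ Y, (1 - stageWeight q K (α y)) = 1 :=
            Finset.prod_eq_one fun y hy => by
              rw [Option.eq_none_iff_forall_ne_some.2 (halive y hy)]
              simp [stageWeight]
          have := hS α
          linarith

lemma exists_separated_subset {s : Set ℤ} (hs : s.Infinite) (d : ℤ) (J : ℕ) :
    ∃ Y : Finset ℤ, (Y : Set ℤ) ⊆ s ∧ Y.card = J ∧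
      ∀ y ∈ Y, ∀ y' ∈ Y, y ≠ y' → d ≤ |y - y'| := by
  induction J with
  | zero => exact ⟨∅, by simp, rfl, by simp⟩
  | succ J ih =>
    obtain ⟨Y, hYs, hYJ, hY⟩ := ih
    -- the last summand keeps the new element out of `Y` also when `d ≤ 0`
    obtain ⟨v, hv, hvY⟩ := hs.exists_notMem_finset ((Y.biUnion fun y => Finset.Icc (y - d) (y + d)) ∪ Y)
    rw [Finset.mem_union, not_or, Finset.mem_biUnion] at hvY
    have hfar : ∀ y ∈ Y, d ≤ |v - y| := by
      intro y hy
      by_contra hc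
      rw [not_le, abs_lt] at hc
      exact hvY.1 ⟨y, hy, Finset.mem_Icc.2 ⟨by omega, by omega⟩⟩
    refine ⟨insert v Y, ?_, by rw [Finset.card_insert_of_notMem hvY.2, hYJ], ?_⟩
    · rw [Finset.coe_insert]
      exact Set.insert_subset hv hYs
    · intro y hy y' hy' hne
      rw [Finset.mem_insert] at hy hy'
      rcases hy with rfl | hy <;> rcases hy' with rfl | hy'
      · exact absurd rfl hne
      · exact hfar y' hy'
      · rw [abs_sub_comm]; exact hfar y hy
      · exact hY y hy y' hy' hne

/-! ### Opinion `1` wins -/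

/-- A bound for the probability of opinion `0` at `x`, in a window of arbitrary size. Here `ε` comes
from the attempts which fail, and from the intervals which are created and later disappear. -/
lemma exists_forall_measure_notMem_le {Ω : Type*} [MeasurableSpace Ω] {P : Measure Ω}
    [IsProbabilityMeasure P] {n : ℕ} (hn : 1 < n) (hev : Even n) {η₀ : Set ℤ}
    (hη₀ : {x : ℤ | MajorityOne (block n x) η₀}.Infinite) {η : ℝ≥0 → Ω → Set ℤ}
    (hη : IsMajorityRuleProcess P n η₀ η) (x : ℤ) {ε : ℝ} (hε : 0 < ε) :
    ∃ γ > 0, ∃ θ > 0, ∃ B E : ℝ, ∃ M₀ : ℕ, ∀ M ≥ M₀, ∀ (k : ℕ) (t : ℝ≥0),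
      P {ω | x ∉ η t ω} ≤ ENNReal.ofReal (ε + B * Real.exp (-(γ * t)) +
        E * Real.exp (-(θ * (M : ℝ))) * t + Real.exp ((2 * M + n + 1 : ℕ) * (t : ℝ)) / 2 ^ k) := by
  obtain ⟨m, rfl⟩ : ∃ m, n = 2 * m := by
    obtain ⟨m, hm⟩ := hev
    exact ⟨m, by omega⟩
  have hm : 0 < m := by omega
  obtain ⟨θ, hθ, γ, hγ, hγ1, hdrift⟩ := exists_exponential_drift hm
  -- the half-length of the interval which an attempt has to create
  obtain ⟨K', hK'⟩ : ∃ K' : ℕ, 2 * Real.exp (θ * (m + 1 - K')) ≤ ε / 2 := by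
    have h1 : Tendsto (fun K' : ℕ => θ * ((m : ℝ) + 1 - K')) atTop atBot := by
      refine Tendsto.const_mul_atBot hθ ?_
      simp only [sub_eq_add_neg]
      exact tendsto_atBot_add_const_left _ _ (tendsto_neg_atTop_atBot.comp tendsto_natCast_atTop_atTop)
    have h2 := (Real.tendsto_exp_atBot.comp h1).const_mul 2
    rw [mul_zero] at h2
    exact (h2.eventually (ge_mem_nhds (half_pos hε))).exists
  set K := 2 * K' + 1 with hKdef
  have hK : 0 < K := by omega
  set q : ℝ := 1 / (2 * (2 * m) + K - 2 : ℕ) with hq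
  have hden : 1 < 2 * (2 * m) + K - 2 := by omega
  have hq0 : 0 < q := by
    have : (0 : ℝ) < (2 * (2 * m) + K - 2 : ℕ) := by exact_mod_cast (by omega)
    positivity
  have hq1 : q < 1 := by
    have : (1 : ℝ) < (2 * (2 * m) + K - 2 : ℕ) := by exact_mod_cast hden
    exact (div_lt_one (by linarith)).2 this
  -- the number of attempts
  obtain ⟨J, hJ⟩ : ∃ J : ℕ, (1 - q ^ K) ^ J < ε / 2 := by
    refine exists_pow_lt_of_lt_one (half_pos hε) ?_
    have : 0 < q ^ K := pow_pos hq0 K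
    linarith
  obtain ⟨Y, hYs, hYJ, hY⟩ := exists_separated_subset hη₀ (2 * (2 * m : ℕ) + K) J
  set b : ℤ → ℝ := fun y => Real.exp (θ * x) * Real.exp (-(θ * (y + (2 * m : ℕ) + K - 2 : ℤ))) +
    Real.exp (-(θ * x)) * Real.exp (θ * y) with hb
  set e : ℤ → ℝ := fun y => m * (Real.exp (θ * ((y + m + K' : ℤ) + (2 * m : ℕ))) +
    Real.exp (θ * ((2 * m : ℕ) - (y + m + K' : ℤ))) + Real.exp (θ * x) + Real.exp (-(θ * x))) with he
  have hb0 : ∀ y, 0 ≤ b y := fun y => by positivity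
  have he0 : ∀ y, 0 ≤ e y := fun y => by positivity
  refine ⟨γ, hγ, θ, hθ, (1 + ∑ y ∈ Y, b y) * J, ∑ y ∈ Y, e y,
    x.natAbs + ∑ y ∈ Y, (y.natAbs + 2 * m + K), fun M hM k t => ?_⟩
  have hxM : x ∈ Set.Icc (-(M : ℤ)) M := by constructor <;> omega
  have hYM : ∀ y ∈ Y, -(M : ℤ) ≤ y ∧ y + (2 * m : ℕ) + K - 2 ≤ M := by
    intro y hy
    have h1 : y.natAbs + 2 * m + K ≤ ∑ y ∈ Y, (y.natAbs + 2 * m + K) :=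
      Finset.single_le_sum (f := fun y : ℤ => y.natAbs + 2 * m + K) (fun _ _ => Nat.zero_le _) hy
    push_cast
    constructor <;> omega
  set D : ℝ := (∑ y ∈ Y, e y) * Real.exp (-(θ * (M : ℝ))) with hD
  have hD0 : 0 ≤ D := mul_nonneg (Finset.sum_nonneg fun y _ => he0 y) (Real.exp_pos _).le
  have hlong : ∀ k, ∀ y ∈ Y, ∀ ζ : Set ℤ, Set.Icc y (y + (2 * m : ℕ) + K - 2) ⊆ ζ →
      BadBound (fun i => windowUpdate (2 * m) M (windowSite (2 * m) M i)) (fun ζ => x ∉ ζ) γ D k ζ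
        (ε / 2) (1 + ∑ y ∈ Y, b y) := by
    intro k y hy ζ hζ
    have hle : m * Real.exp (-(θ * (M : ℝ))) * (Real.exp (θ * ((y + m + K' : ℤ) + (2 * m : ℕ))) +
        Real.exp (θ * ((2 * m : ℕ) - (y + m + K' : ℤ))) + Real.exp (θ * x) + Real.exp (-(θ * x)))
        ≤ D := by
      have h1 := mul_le_mul_of_nonneg_right (Finset.single_le_sum (fun y _ => he0 y) hy)
        (Real.exp_pos (-(θ * (M : ℝ)))).le
      refine le_trans (le_of_eq ?_) h1
      simp only [he]
      ring
    refine (badBound_of_Icc_subset hm hdrift hθ hγ hle k y (y + (2 * m : ℕ) + K - 2) (hYM y hy).1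
      (hYM y hy).2 ζ hζ).mono (le_trans ?_ hK') ?_
    · rw [← Real.exp_add, ← Real.exp_add, two_mul (Real.exp _)]
      refine add_le_add (Real.exp_le_exp.2 ?_) (Real.exp_le_exp.2 ?_)
      · rw [hKdef]
        push_cast
        linarith
      · push_cast
        linarith
    · have := Finset.single_le_sum (fun y _ => hb0 y) hy
      linarith
  have hbound := badBound_of_stageHolds (by omega : 2 ≤ 2 * m) hK hγ hγ1 hD0 (half_pos hε).le
    (le_add_of_nonneg_right (Finset.sum_nonneg fun y _ => hb0 y)) hYM
    (by push_cast at hY ⊢; exact hY) hlong k (fun _ => some 0) (by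
      intro y _ j hj
      simp only [Option.some.injEq] at hj
      omega) (η₀ ∩ Set.Icc (-(M : ℤ)) M) (by
      intro y hy
      have h1 : MajorityOne (block (2 * m) y) η₀ := hYs hy
      refine h1.of_inter_subset ?_
      rintro w ⟨hw, hwb⟩
      have h2 := mem_block.1 (Finset.mem_coe.1 hwb)
      have h3 := hYM y hy
      exact ⟨hw, by omega, by omega⟩) t t.2
  refine (hη.measure_notMem_le hxM k t).trans (hbound.trans (ENNReal.ofReal_le_ofReal ?_))
  simp only [stageWeight, aliveIndicator, Finset.prod_const, Finset.sum_const, hYJ, nsmul_eq_mul,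
    mul_one, Nat.sub_zero, ← hq]
  have hcoe : ((t : ℝ≥0) : ℝ) = t.1 := rfl
  rw [hcoe]
  linarith

theorem mainTheorem1 {Ω : Type*} [MeasurableSpace Ω] (P : Measure Ω) [IsProbabilityMeasure P]
    (n : ℕ) (hn : 1 < n) (hev : Even n) (η₀ : Set ℤ)
    (hη₀ : {x : ℤ | MajorityOne (block n x) η₀}.Infinite)
    (η : ℝ≥0 → Ω → Set ℤ) (hη : IsMajorityRuleProcess P n η₀ η) (x : ℤ) :
    Tendsto (fun t : ℝ≥0 => P {ω | x ∉ η t ω}) atTop (𝓝 0) := by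
  -- a bound free of the window and of the number of rings
  have key : ∀ ε : ℝ, 0 < ε → ∃ γ > 0, ∃ B : ℝ, ∀ t : ℝ≥0,
      P {ω | x ∉ η t ω} ≤ ENNReal.ofReal (ε + B * Real.exp (-(γ * t))) := by
    intro ε hε
    obtain ⟨γ, hγ, θ, hθ, B, E, M₀, h⟩ := exists_forall_measure_notMem_le hn hev hη₀ hη x hε
    refine ⟨γ, hγ, B, fun t => ?_⟩
    have hk : ∀ M ≥ M₀, P {ω | x ∉ η t ω} ≤ ENNReal.ofReal (ε + B * Real.exp (-(γ * t)) +
        E * Real.exp (-(θ * (M : ℝ))) * t) := by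
      intro M hM
      have hlim : Tendsto (fun k : ℕ => ε + B * Real.exp (-(γ * t)) +
          E * Real.exp (-(θ * (M : ℝ))) * t + Real.exp ((2 * M + n + 1 : ℕ) * (t : ℝ)) / 2 ^ k)
          atTop (𝓝 (ε + B * Real.exp (-(γ * t)) + E * Real.exp (-(θ * (M : ℝ))) * t + 0)) :=
        tendsto_const_nhds.add
          (tendsto_const_nhds.div_atTop (tendsto_pow_atTop_atTop_of_one_lt one_lt_two))
      rw [add_zero] at hlim
      exact ge_of_tendsto' (ENNReal.tendsto_ofReal hlim) fun k => h M hM k t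
    have hM : Tendsto (fun M : ℕ => Real.exp (-(θ * (M : ℝ)))) atTop (𝓝 0) :=
      Real.tendsto_exp_neg_atTop_nhds_zero.comp
        (tendsto_natCast_atTop_atTop.const_mul_atTop hθ)
    have hlim : Tendsto (fun M : ℕ => ε + B * Real.exp (-(γ * t)) +
        E * Real.exp (-(θ * (M : ℝ))) * t) atTop
        (𝓝 (ε + B * Real.exp (-(γ * t)) + E * 0 * t)) :=
      tendsto_const_nhds.add ((hM.const_mul E).mul_const _)
    rw [mul_zero, zero_mul, add_zero] at hlim
    exact ge_of_tendsto (ENNReal.tendsto_ofReal hlim) (eventually_atTop.2 ⟨M₀, hk⟩)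
  rw [ENNReal.tendsto_nhds_zero]
  intro δ hδ
  obtain ⟨ε, hε, hεδ⟩ : ∃ ε : ℝ, 0 < ε ∧ ENNReal.ofReal (2 * ε) ≤ δ := by
    rcases eq_or_ne δ ⊤ with rfl | htop
    · exact ⟨1, one_pos, le_top⟩
    · refine ⟨δ.toReal / 2, half_pos (ENNReal.toReal_pos hδ.ne' htop), ?_⟩
      rw [mul_div_cancel₀ _ two_ne_zero, ENNReal.ofReal_toReal htop]
  obtain ⟨γ, hγ, B, h⟩ := key ε hε
  have hlim : Tendsto (fun t : ℝ≥0 => B * Real.exp (-(γ * (t : ℝ)))) atTop (𝓝 (B * 0)) :=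
    (Real.tendsto_exp_neg_atTop_nhds_zero.comp
      ((NNReal.tendsto_coe_atTop.2 tendsto_id).const_mul_atTop hγ)).const_mul B
  rw [mul_zero] at hlim
  filter_upwards [hlim.eventually (ge_mem_nhds hε)] with t ht
  exact (h t).trans ((ENNReal.ofReal_le_ofReal (by linarith)).trans hεδ)
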